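/- Let $H$ and $K$ be locally compact Hausdorff topological groups, let $X$ be a locally compact Hausdorff space and let $\mathbf B=\{B_x\}_{x\in X}$ be an upper semicontinuous $C^*$-bundle over $X$, with total space $p:B\to X$. Let $(\alpha,\cdot)$ and $(\beta,\star)$ be partial actions of $H$ and $K$ on $\mathbf B$: pairs of continuous partial actions on $B$ and on $X$ such that the range of $\alpha_s$ is $p^{-1}(X^H_s)$, $p$ is a morphism of partial actions, and $\alpha_s$ restricts to $*$-homomorphisms of fibers (similarly for $\beta$); here the partial actions on $X$ are by maps $X^H_{s^{-1}}\to X^H_s$ and $X^K_{t^{-1}}\to X^K_t$. Assume that the partial action $\cdot$ of $H$ on $X$ is free (all stabilizers are trivial) and proper (the map $(s,x)\mapsto (x,s\cdot x)$, defined for $x\in X^H_{s^{-1}}$, has compact preimages of compact sets), and that $\alpha$ and $\beta$ commute, i.e. on the base space $s\cdot(X^H_{s^{-1}}\cap X^K_t)=t\star(X^K_{t^{-1}}\cap X^H_s)$ and $s\cdot(t\star x)=t\star(s\cdot x)$ whenever $x\in X^H_{s^{-1}}$ and $s\cdot x\in X^K_{t^{-1}}$, and likewise on the total space. Let $\mathbf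 B/H$ be the orbit bundle $B/H\to X/H$, whose fiber over $Hx$ is the $C^*$-algebra $B_x$ via $b\mapsto Hb$. Let $\operatorname{Ind}_0(\mathbf B,\alpha)$ be the set of bounded continuous sections $f$ of $\mathbf B$ that are morphisms of partial actions (so $\alpha_s(f(x))=f(s\cdot x)$ for $x\in X^H_{s^{-1}}$) and for which the section $\operatorname{Ind}(f):Hx\mapsto Hf(x)$ belongs to $C_0(\mathbf B/H)$, with the supremum norm and pointwise operations. Then $\operatorname{Ind}_0(\mathbf B,\alpha)$ is a $C^*$-algebra and $(\operatorname{Ind}_0(\mathbf B,\alpha),K,\widehat\beta)$ is a $C^*$-partial dynamical system (a partial action by $*$-isomorphisms $\widehat\beta_t$ between closed two-sided ideals $\operatorname{Ind}_0(\mathbf B,\alpha)_{t^{-1}}\to \operatorname{Ind}_0(\mathbf B,\alpha)_t$ that form a continuous family, jointly continuous in $t$ and the algebra variable), where (1) $\operatorname{Ind}_0(\mathbf B,\alpha)_t=\{f\in \operatorname{Ind}_0(\mathbf B,\alpha):\ x\mapsto\|f(x)\| \text{ vanishes outside } X^K_t\}$; (2) for $f\in \operatorname{Ind}_0(\mathbf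 B,\alpha)_{t^{-1}}$, $\widehat\beta_t(f)(x)=\beta_t(f(t^{-1}\star x))$ if $x\in X^K_t$, and $\widehat\beta_t(f)(x)=0_x$ otherwise. Moreover, $\mathbf B/H$ is an upper semicontinuous $C^*$-bundle, $\beta$ induces a partial action $\mu$ of $K$ on it, with $(X/H)_t=HX^K_t$, $t\star Hx=H(t\star x)$ for $x\in X^K_{t^{-1}}$ and $\mu_t(Hb)=H\beta_t(b)$ for $b$ in the domain of $\beta_t$; and $\operatorname{Ind}$ is a $*$-isomorphism of $\operatorname{Ind}_0(\mathbf B,\alpha)$ onto $C_0(\mathbf B/H)$ which maps $\operatorname{Ind}_0(\mathbf B,\alpha)_t$ onto $C_0(\mathbf B/H)_t$ for every $t\in K$ and carries $\widehat\beta$ to the partial action $\widetilde\mu$ of $K$ on the $C^*$-algebra $C_0(\mathbf B/H)$, where $C_0(\mathbf B/H)_t$ is the ideal of sections vanishing outside $(X/H)_t$, and $\widetilde\mu_t(g)(z)=\mu_t(g(t^{-1}\star z))$ if $z\in (X/H)_t$ and $0_z$ otherwise; $(C_0(\mathbf B/H),K,\widetilde\mu)$ is also a $C^*$-partial dynamical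 system. -/

import Mathlib

open Set Filter Topology
open scoped ENNReal

/-! ### Partial actions on sets and spaces -/

/-- A (set-theoretic) partial action of `G` on `X`. The set `dom t` is `X_t`, and `act t` stands for
the bijection `X_{t⁻¹} → X_t`; the values of `act t` outside `X_{t⁻¹}` carry no information. -/
structure PartialAction (G X : Type*) [Group G] where
  dom : G → Set X
  act : G → X → X
  dom_one : dom 1 = univ
  act_one : ∀ x, act 1 x = x
  bijOn : ∀ t, BijOn (act t) (dom t⁻¹) (dom t)
  comp : ∀ s t x, x ∈ dom t⁻¹ → act t x ∈ dom s⁻¹ →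
    x ∈ dom (s * t)⁻¹ ∧ act (s * t) x = act s (act t x)

namespace PartialAction

variable {G H K X Y : Type*} [Group G] [Group H] [Group K]

/-- The domain `{(t, x) | x ∈ X_{t⁻¹}}` of a partial action. -/
def graphDom (a : PartialAction G X) : Set (G × X) := {p | p.2 ∈ a.dom p.1⁻¹}

/-- Continuity: the domain is open and `(t, x) ↦ a_t(x)` is continuous on it. -/
def IsCont [TopologicalSpace G] [TopologicalSpace X] (a : PartialAction G X) : Prop :=
  IsOpen a.graphDom ∧ ContinuousOn (fun p : G × X => a.act p.1 p.2) a.graphDom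

/-- Morphisms of partial actions. -/
def IsMorphism [TopologicalSpace X] [TopologicalSpace Y] (a : PartialAction G X)
    (b : PartialAction G Y) (f : X → Y) : Prop :=
  Continuous f ∧ (∀ t, MapsTo f (a.dom t) (b.dom t)) ∧
    ∀ t, ∀ x ∈ a.dom t⁻¹, b.act t (f x) = f (a.act t x)

/-- All stabilizers are trivial. -/
def IsFree (a : PartialAction G X) : Prop :=
  ∀ x t, x ∈ a.dom t⁻¹ → a.act t x = x → t = 1

/-- The map `(t, x) ↦ (x, a_t(x))`, from the domain of `a` to `X × X`, is proper: preimages of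
compact sets are compact. -/
def IsProper [TopologicalSpace G] [TopologicalSpace X] (a : PartialAction G X) : Prop :=
  ∀ C : Set (X × X), IsCompact C →
    IsCompact {p : G × X | p ∈ a.graphDom ∧ (p.2, a.act p.1 p.2) ∈ C}

/-- Commuting partial actions of two groups on the same set. -/
def Commutes (a : PartialAction H X) (b : PartialAction K X) : Prop :=
  ∀ s t, a.act s '' (a.dom s⁻¹ ∩ b.dom t) = b.act t '' (b.dom t⁻¹ ∩ a.dom s) ∧
    ∀ x ∈ a.act s⁻¹ '' (a.dom s ∩ b.dom t⁻¹), a.act s (b.act t x) = b.act t (a.act s x)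

lemma act_mem (a : PartialAction G X) {t : G} {x : X} (h : x ∈ a.dom t⁻¹) :
    a.act t x ∈ a.dom t := (a.bijOn t).mapsTo h

lemma act_inv_act (a : PartialAction G X) {t : G} {x : X} (h : x ∈ a.dom t⁻¹) :
    a.act t⁻¹ (a.act t x) = x := by
  have := (a.comp t⁻¹ t x h (by simpa using a.act_mem h)).2
  rw [← this, inv_mul_cancel, a.act_one]

/-- `x ∼ y` if and only if `y = a_t(x)` for some `t` with `x ∈ X_{t⁻¹}`. -/
def orbitSetoid (a : PartialAction G X) : Setoid X where
  r x y := ∃ t, x ∈ a.dom t⁻¹ ∧ a.act t x = y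
  iseqv := by
    refine ⟨fun x => ⟨1, by simp [a.dom_one], a.act_one x⟩, ?_, ?_⟩
    · rintro x y ⟨t, hx, rfl⟩
      exact ⟨t⁻¹, by simpa using a.act_mem hx, a.act_inv_act hx⟩
    · rintro x y z ⟨t, hx, rfl⟩ ⟨s, hy, rfl⟩
      exact ⟨s * t, a.comp s t x hx hy⟩

/-- The orbit space `X/G`, with the quotient topology. -/
abbrev OrbitSpace (a : PartialAction G X) : Type _ := Quotient a.orbitSetoid

/-- The orbit map `X → X/G`. -/
abbrev orbit (a : PartialAction G X) (x : X) : a.OrbitSpace := Quotient.mk a.orbitSetoid x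

end PartialAction

/-! ### Upper semicontinuous C*-bundles -/

/-- The total space of a family of fibers. -/
abbrev Tot {X : Type*} (B : X → Type*) : Type _ := Bundle.TotalSpace Unit B

/-- The topology of the space of pairs of points in a common fiber, as a subspace of
`Tot B × Tot B`. -/
@[reducible] def fiberPairTopology {X : Type*} (B : X → Type*) [TopologicalSpace (Tot B)] :
    TopologicalSpace (Σ x, B x × B x) :=
  TopologicalSpace.induced
    (fun q => ((⟨q.1, q.2.1⟩, ⟨q.1, q.2.2⟩) : Tot B × Tot B)) inferInstance

/-- The given topology on the total space makes `Tot B → X` an upper semicontinuous C*-bundle. -/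
structure IsUSCCStarBundle {X : Type*} [TopologicalSpace X] (B : X → Type*)
    [∀ x, NonUnitalCStarAlgebra (B x)] [TopologicalSpace (Tot B)] : Prop where
  continuous_proj : Continuous (fun b : Tot B => b.proj)
  isOpenMap_proj : IsOpenMap (fun b : Tot B => b.proj)
  surjective_proj : Function.Surjective (fun b : Tot B => b.proj)
  isOpen_norm_lt : ∀ ε : ℝ, 0 < ε → IsOpen {b : Tot B | ‖b.snd‖ < ε}
  continuous_add : Continuous[fiberPairTopology B, inferInstance]
    (fun q => (⟨q.1, q.2.1 + q.2.2⟩ : Tot B))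
  continuous_mul : Continuous[fiberPairTopology B, inferInstance]
    (fun q => (⟨q.1, q.2.1 * q.2.2⟩ : Tot B))
  continuous_smul : ∀ k : ℂ, Continuous (fun b : Tot B => (⟨b.proj, k • b.snd⟩ : Tot B))
  continuous_star : Continuous (fun b : Tot B => (⟨b.proj, star b.snd⟩ : Tot B))
  /-- If `p(b_i) → x` and `‖b_i‖ → 0`, then `b_i → 0_x` (stated with filters in place of nets). -/
  le_nhds_zero : ∀ (x : X) (l : Filter (Tot B)), Tendsto (fun b : Tot B => b.proj) l (𝓝 x) →
    Tendsto (fun b : Tot B => ‖b.snd‖) l (𝓝 0) → l ≤ 𝓝 (⟨x, 0⟩ : Tot B)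

section Sections

variable {X : Type*} [TopologicalSpace X] {B : X → Type*} [∀ x, NonUnitalCStarAlgebra (B x)]

/-- The section `f`, as a map into the total space, is continuous. -/
def ContSection [TopologicalSpace (Tot B)] (f : ∀ x, B x) : Prop :=
  Continuous (fun x => (⟨x, f x⟩ : Tot B))

/-- The section `f` vanishes at infinity. -/
def VanishesAtInfinity (f : ∀ x, B x) : Prop :=
  ∀ ε : ℝ, 0 < ε → IsCompact {x | ε ≤ ‖f x‖}

lemma vanishes_zero : VanishesAtInfinity (0 : ∀ x, B x) := by
  intro ε hε
  have : {x | ε ≤ ‖(0 : ∀ x, B x) x‖} = ∅ := by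
    ext x
    simp [hε]
  rw [this]
  exact isCompact_empty

lemma VanishesAtInfinity.of_le {f g h : ∀ x, B x} {C : ℝ} (hC : 0 < C)
    (hf : VanishesAtInfinity f) (hg : VanishesAtInfinity g)
    (hcl : ∀ ε : ℝ, 0 < ε → IsClosed {x | ε ≤ ‖h x‖})
    (hle : ∀ x, ‖h x‖ ≤ C * (‖f x‖ + ‖g x‖)) : VanishesAtInfinity h := by
  intro ε hε
  have hδ : 0 < ε / (2 * C) := by positivity
  refine ((hf _ hδ).union (hg _ hδ)).of_isClosed_subset (hcl ε hε) ?_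
  intro x hx
  by_contra hcon
  simp only [mem_union, Set.mem_ofPred_eq, not_or, not_le] at hcon hx
  have h1 : ‖f x‖ + ‖g x‖ < ε / (2 * C) + ε / (2 * C) := add_lt_add hcon.1 hcon.2
  have h2 : C * (ε / (2 * C) + ε / (2 * C)) = ε := by field_simp; norm_num
  have h3 := mul_lt_mul_of_pos_left h1 hC
  linarith [hle x]

variable [TopologicalSpace (Tot B)]

lemma ContSection.isClosed_le (hB : IsUSCCStarBundle B) {f : ∀ x, B x} (hf : ContSection f)
    {ε : ℝ} (hε : 0 < ε) : IsClosed {x | ε ≤ ‖f x‖} := by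
  rw [← isOpen_compl_iff]
  have h := (hB.isOpen_norm_lt ε hε).preimage hf
  convert h using 1
  ext x
  simp

lemma contSection_zero (hB : IsUSCCStarBundle B) : ContSection (0 : ∀ x, B x) := by
  refine continuous_iff_continuousAt.2 fun x => ?_
  have h := hB.le_nhds_zero x (map (fun y => (⟨y, 0⟩ : Tot B)) (𝓝 x))
    (by rw [tendsto_map'_iff]; exact tendsto_id)
    (by rw [tendsto_map'_iff]; simp [Function.comp_def])
  exact h

lemma ContSection.pair {f g : ∀ x, B x} (hf : ContSection f) (hg : ContSection g) :
    Continuous[inferInstance, fiberPairTopology B]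
      (fun x => (⟨x, (f x, g x)⟩ : Σ x, B x × B x)) :=
  continuous_induced_rng.2 (Continuous.prodMk hf hg)

lemma ContSection.add (hB : IsUSCCStarBundle B) {f g : ∀ x, B x} (hf : ContSection f)
    (hg : ContSection g) : ContSection (f + g) :=
  @Continuous.comp _ _ _ _ (fiberPairTopology B) _ _ _ hB.continuous_add (hf.pair hg)

lemma ContSection.mul (hB : IsUSCCStarBundle B) {f g : ∀ x, B x} (hf : ContSection f)
    (hg : ContSection g) : ContSection (f * g) :=
  @Continuous.comp _ _ _ _ (fiberPairTopology B) _ _ _ hB.continuous_mul (hf.pair hg)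

lemma ContSection.smul (hB : IsUSCCStarBundle B) (k : ℂ) {f : ∀ x, B x} (hf : ContSection f) :
    ContSection (k • f) := (hB.continuous_smul k).comp hf

lemma ContSection.star (hB : IsUSCCStarBundle B) {f : ∀ x, B x} (hf : ContSection f) :
    ContSection (star f) := hB.continuous_star.comp hf

/-- The *-algebra `C_b(B)` of bounded continuous sections, inside the C*-algebra `lp B ∞` of all
bounded sections with the supremum norm. -/
def cb (hB : IsUSCCStarBundle B) : NonUnitalStarSubalgebra ℂ (lp B ∞) where
  carrier := {f | ContSection (⇑f)}
  zero_mem' := contSection_zero hB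
  add_mem' hf hg := ContSection.add hB hf hg
  mul_mem' hf hg := ContSection.mul hB hf hg
  smul_mem' k _ hf := ContSection.smul hB k hf
  star_mem' hf := ContSection.star hB hf

lemma vanishes_add {f g : ∀ x, B x} (hf : VanishesAtInfinity f) (hg : VanishesAtInfinity g)
    (hcl : ∀ ε : ℝ, 0 < ε → IsClosed {x | ε ≤ ‖(f + g) x‖}) : VanishesAtInfinity (f + g) :=
  VanishesAtInfinity.of_le one_pos hf hg hcl fun x => by simpa using norm_add_le (f x) (g x)

lemma vanishes_smul {f : ∀ x, B x} (k : ℂ) (hf : VanishesAtInfinity f)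
    (hcl : ∀ ε : ℝ, 0 < ε → IsClosed {x | ε ≤ ‖(k • f) x‖}) : VanishesAtInfinity (k • f) :=
  VanishesAtInfinity.of_le (C := ‖k‖ + 1) (by positivity) hf hf hcl fun x => by
    rw [Pi.smul_apply, norm_smul]
    nlinarith [norm_nonneg k, norm_nonneg (f x), mul_nonneg (norm_nonneg k) (norm_nonneg (f x))]

lemma vanishes_mul {f g : ∀ x, B x} {C : ℝ} (hC : ∀ x, ‖f x‖ ≤ C) (hC' : 0 ≤ C)
    (hg : VanishesAtInfinity g)
    (hcl : ∀ ε : ℝ, 0 < ε → IsClosed {x | ε ≤ ‖(f * g) x‖}) : VanishesAtInfinity (f * g) :=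
  VanishesAtInfinity.of_le (C := C + 1) (by positivity) hg hg hcl fun x => by
    have h1 : ‖(f * g) x‖ ≤ ‖f x‖ * ‖g x‖ := norm_mul_le (f x) (g x)
    nlinarith [norm_nonneg (g x), hC x, mul_le_mul_of_nonneg_right (hC x) (norm_nonneg (g x)),
      mul_nonneg hC' (norm_nonneg (g x))]

lemma vanishes_star {f : ∀ x, B x} (hf : VanishesAtInfinity f) : VanishesAtInfinity (star f) := by
  intro ε hε
  simpa using hf ε hε

/-- The *-algebra `C_0(B)` of continuous sections vanishing at infinity. -/
def cZero (hB : IsUSCCStarBundle B) : NonUnitalStarSubalgebra ℂ (lp B ∞) where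
  carrier := {f | f ∈ cb hB ∧ VanishesAtInfinity (⇑f)}
  zero_mem' := ⟨zero_mem _, vanishes_zero⟩
  add_mem' hf hg := ⟨add_mem hf.1 hg.1, vanishes_add hf.2 hg.2 fun _ hε =>
    ContSection.isClosed_le hB (ContSection.add hB hf.1 hg.1) hε⟩
  mul_mem' {f g} hf hg := ⟨mul_mem hf.1 hg.1,
    vanishes_mul (lp.norm_apply_le_norm ENNReal.top_ne_zero f) (norm_nonneg f) hg.2
      fun _ hε => ContSection.isClosed_le hB (ContSection.mul hB hf.1 hg.1) hε⟩
  smul_mem' k _ hf := ⟨SMulMemClass.smul_mem k hf.1, vanishes_smul k hf.2 fun _ hε =>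
    ContSection.isClosed_le hB (ContSection.smul hB k hf.1) hε⟩
  star_mem' hf := ⟨star_mem hf.1, vanishes_star hf.2⟩

end Sections

/-! ### Partial actions on bundles -/

/-- A (continuous) partial action of `G` on the bundle `B`: a pair of continuous partial actions, on
the total and on the base space. -/
structure BundlePartialAction (G : Type*) [Group G] [TopologicalSpace G] {X : Type*}
    [TopologicalSpace X] (B : X → Type*) [∀ x, NonUnitalCStarAlgebra (B x)]
    [TopologicalSpace (Tot B)] where
  total : PartialAction G (Tot B)
  base : PartialAction G X
  total_cont : total.IsCont
  base_cont : base.IsCont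
  preimage_dom : ∀ t, (fun b : Tot B => b.proj) ⁻¹' base.dom t = total.dom t
  proj_morphism : total.IsMorphism base (fun b : Tot B => b.proj)
  fiber_hom : ∀ t, ∀ x ∈ base.dom t⁻¹, ∃ φ : B x →⋆ₙₐ[ℂ] B (base.act t x),
    ∀ b : B x, total.act t ⟨x, b⟩ = ⟨base.act t x, φ b⟩

namespace BundlePartialAction

variable {G H K : Type*} [Group G] [TopologicalSpace G] [Group H] [TopologicalSpace H]
  [Group K] [TopologicalSpace K] {X : Type*} [TopologicalSpace X] {B : X → Type*}
  [∀ x, NonUnitalCStarAlgebra (B x)] [TopologicalSpace (Tot B)]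

def IsFree (α : BundlePartialAction G B) : Prop := α.base.IsFree

def IsProper (α : BundlePartialAction G B) : Prop := α.base.IsProper

def Commutes (α : BundlePartialAction H B) (β : BundlePartialAction K B) : Prop :=
  α.total.Commutes β.total ∧ α.base.Commutes β.base

/-! The orbit bundle `B/G → X/G`. For a free action the fiber of `B/G` over an orbit `z` is
identified with `B_x` (as a C*-algebra, by `b ↦ Gb`) for any point `x` of `z`; the point `x` used
here is the chosen representative `z.out`. The total space of this family of fibers is identified
with the orbit space of the total space of `B` by `toOrbit`, and carries its topology. -/

/-- The fiber of the orbit bundle over an orbit. -/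
def OrbitFiber (α : BundlePartialAction G B) (z : α.base.OrbitSpace) : Type _ := B z.out

noncomputable instance (α : BundlePartialAction G B) (z : α.base.OrbitSpace) :
    NonUnitalCStarAlgebra (α.OrbitFiber z) :=
  inferInstanceAs (NonUnitalCStarAlgebra (B z.out))

/-- The map (bijective if `α` is free) from the total space of the orbit bundle to the orbit
space of the total space. -/
noncomputable def toOrbit (α : BundlePartialAction G B) (c : Tot α.OrbitFiber) : α.total.OrbitSpace :=
  α.total.orbit ⟨c.proj.out, c.snd⟩

noncomputable instance (α : BundlePartialAction G B) : TopologicalSpace (Tot α.OrbitFiber) :=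
  TopologicalSpace.induced α.toOrbit inferInstance

/-- `Ind f : z ↦ G f(x)`, for `x ∈ z`. -/
noncomputable def ind (α : BundlePartialAction G B) (f : ∀ x, B x) : ∀ z, α.OrbitFiber z := fun z => f z.out

/-- The section `f`, as a map `X → Tot B`, is a morphism of partial actions. -/
def IsEquivariant (α : BundlePartialAction G B) (f : ∀ x, B x) : Prop :=
  α.base.IsMorphism α.total (fun x => (⟨x, f x⟩ : Tot B))

lemma isEquivariant_iff (α : BundlePartialAction G B) {f : ∀ x, B x} (hf : ContSection f) :
    α.IsEquivariant f ↔ ∀ t, ∀ x ∈ α.base.dom t⁻¹,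
      α.total.act t ⟨x, f x⟩ = ⟨α.base.act t x, f (α.base.act t x)⟩ := by
  refine ⟨fun h => h.2.2, fun h => ⟨hf, fun t x hx => ?_, h⟩⟩
  rw [← α.preimage_dom]
  exact hx

lemma toOrbit_ind (α : BundlePartialAction G B) {f : ∀ x, B x} (hf : α.IsEquivariant f) (x : X) :
    α.toOrbit ⟨α.base.orbit x, α.ind f (α.base.orbit x)⟩ = α.total.orbit ⟨x, f x⟩ := by
  obtain ⟨t, ht, he⟩ := Quotient.mk_out (s := α.base.orbitSetoid) x
  refine Quotient.sound ⟨t, ?_, ?_⟩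
  · rw [← α.preimage_dom]
    exact ht
  · have h := hf.2.2 t _ ht
    rw [he] at h
    exact h

lemma contSection_ind (α : BundlePartialAction G B) {f : ∀ x, B x} (hf : α.IsEquivariant f) :
    ContSection (α.ind f) := by
  refine continuous_induced_rng.2 (continuous_coinduced_dom.2 ?_)
  have h : Continuous fun x => α.total.orbit ⟨x, f x⟩ := continuous_quotient_mk'.comp hf.1
  exact h.congr fun x => (α.toOrbit_ind hf x).symm

/-- The partial action on the total space preserves the norm. -/
lemma norm_act (α : BundlePartialAction G B) {t : G} {x : X} (hx : x ∈ α.base.dom t⁻¹) (b : B x) :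
    ‖(α.total.act t ⟨x, b⟩).snd‖ = ‖b‖ := by
  have key : ∀ (t : G) (c : Tot B), c.proj ∈ α.base.dom t⁻¹ → ‖(α.total.act t c).snd‖ ≤ ‖c.snd‖ := by
    rintro t ⟨y, c⟩ hy
    obtain ⟨φ, hφ⟩ := α.fiber_hom t y hy
    rw [hφ c]
    exact NonUnitalStarAlgHom.norm_apply_le φ c
  refine le_antisymm (key t _ hx) ?_
  have hm : (⟨x, b⟩ : Tot B) ∈ α.total.dom t⁻¹ := by
    rw [← α.preimage_dom]
    exact hx
  have h1 := α.total.act_mem hm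
  rw [← α.preimage_dom] at h1
  have h2 := key t⁻¹ (α.total.act t ⟨x, b⟩) (by simpa using h1)
  rwa [α.total.act_inv_act hm] at h2

lemma norm_ind (α : BundlePartialAction G B) {f : ∀ x, B x} (hf : α.IsEquivariant f) (x : X) :
    ‖α.ind f (α.base.orbit x)‖ = ‖f x‖ := by
  obtain ⟨t, ht, he⟩ := Quotient.mk_out (s := α.base.orbitSetoid) x
  have h := hf.2.2 t _ ht
  have h1 := α.norm_act ht (f (α.base.orbit x).out)
  rw [h, he] at h1
  exact h1.symm

lemma isClosed_ind (hB : IsUSCCStarBundle B) (α : BundlePartialAction G B) {f : ∀ x, B x}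
    (hf : α.IsEquivariant f) {ε : ℝ} (hε : 0 < ε) : IsClosed {z | ε ≤ ‖α.ind f z‖} := by
  refine isClosed_coinduced.2 ?_
  have h := ContSection.isClosed_le hB hf.1 hε
  convert h using 1
  ext x
  change ε ≤ ‖α.ind f (α.base.orbit x)‖ ↔ ε ≤ ‖f x‖
  rw [α.norm_ind hf x]

/-- The induced algebra `Ind_b(B, α)`: the bounded continuous sections which are morphisms of
partial actions. -/
def indB (hB : IsUSCCStarBundle B) (α : BundlePartialAction G B) :
    NonUnitalStarSubalgebra ℂ (lp B ∞) where
  carrier := {f | f ∈ cb hB ∧ α.IsEquivariant (⇑f)}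
  zero_mem' := by
    refine ⟨zero_mem _, (α.isEquivariant_iff (contSection_zero hB)).2 fun t x hx => ?_⟩
    obtain ⟨φ, hφ⟩ := α.fiber_hom t x hx
    exact (hφ 0).trans (by rw [map_zero]; rfl)
  add_mem' {f g} hf hg := by
    refine ⟨add_mem hf.1 hg.1, (α.isEquivariant_iff (add_mem hf.1 hg.1)).2 fun t x hx => ?_⟩
    obtain ⟨φ, hφ⟩ := α.fiber_hom t x hx
    have h1 := hf.2.2.2 t x hx
    have h2 := hg.2.2.2 t x hx
    simp only [hφ, Bundle.TotalSpace.mk.injEq, heq_eq_eq, true_and] at h1 h2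
    exact (hφ (f x + g x)).trans (by rw [map_add, h1, h2]; rfl)
  mul_mem' {f g} hf hg := by
    refine ⟨mul_mem hf.1 hg.1, (α.isEquivariant_iff (mul_mem hf.1 hg.1)).2 fun t x hx => ?_⟩
    obtain ⟨φ, hφ⟩ := α.fiber_hom t x hx
    have h1 := hf.2.2.2 t x hx
    have h2 := hg.2.2.2 t x hx
    simp only [hφ, Bundle.TotalSpace.mk.injEq, heq_eq_eq, true_and] at h1 h2
    exact (hφ (f x * g x)).trans (by rw [map_mul, h1, h2]; rfl)
  smul_mem' k f hf := by
    refine ⟨SMulMemClass.smul_mem k hf.1,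
      (α.isEquivariant_iff (SMulMemClass.smul_mem k hf.1)).2 fun t x hx => ?_⟩
    obtain ⟨φ, hφ⟩ := α.fiber_hom t x hx
    have h1 := hf.2.2.2 t x hx
    simp only [hφ, Bundle.TotalSpace.mk.injEq, heq_eq_eq, true_and] at h1
    exact (hφ (k • f x)).trans (by rw [map_smul, h1]; rfl)
  star_mem' {f} hf := by
    refine ⟨star_mem hf.1, (α.isEquivariant_iff (star_mem hf.1)).2 fun t x hx => ?_⟩
    obtain ⟨φ, hφ⟩ := α.fiber_hom t x hx
    have h1 := hf.2.2.2 t x hx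
    simp only [hφ, Bundle.TotalSpace.mk.injEq, heq_eq_eq, true_and] at h1
    exact (hφ (star (f x))).trans (by rw [map_star, h1]; rfl)

/-- The induced algebra `Ind_0(B, α)`: the `f ∈ Ind_b(B, α)` for which `Ind f` is a continuous
section of the orbit bundle that vanishes at infinity. -/
def indZero (hB : IsUSCCStarBundle B) (α : BundlePartialAction G B) :
    NonUnitalStarSubalgebra ℂ (lp B ∞) where
  carrier := {f | f ∈ indB hB α ∧ ContSection (α.ind ⇑f) ∧ VanishesAtInfinity (α.ind ⇑f)}
  zero_mem' := ⟨zero_mem _, α.contSection_ind (zero_mem (indB hB α)).2, vanishes_zero⟩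
  add_mem' hf hg := by
    have h := add_mem hf.1 hg.1
    exact ⟨h, α.contSection_ind h.2, vanishes_add (f := α.ind _) (g := α.ind _) hf.2.2 hg.2.2
      fun _ hε => α.isClosed_ind hB h.2 hε⟩
  mul_mem' {f g} hf hg := by
    have h := mul_mem hf.1 hg.1
    exact ⟨h, α.contSection_ind h.2, vanishes_mul (f := α.ind _) (g := α.ind _)
      (fun z => lp.norm_apply_le_norm ENNReal.top_ne_zero f z.out) (norm_nonneg f) hg.2.2
      fun _ hε => α.isClosed_ind hB h.2 hε⟩
  smul_mem' k f hf := by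
    have h : k • f ∈ indB hB α := SMulMemClass.smul_mem k hf.1
    exact ⟨h, α.contSection_ind h.2, vanishes_smul (f := α.ind _) k hf.2.2
      fun _ hε => α.isClosed_ind hB h.2 hε⟩
  star_mem' hf := by
    have h := star_mem hf.1
    exact ⟨h, α.contSection_ind h.2, vanishes_star (f := α.ind _) hf.2.2⟩

/-- `μ` is the partial action induced by `β` on the orbit bundle of `α`: `(X/H)_t = H X^K_t`,
`t ⋆ Hx = H(t ⋆ x)` and `μ_t(Hb) = H β_t(b)`. -/
def IsQuotientAction (α : BundlePartialAction H B) (β : BundlePartialAction K B)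
    (μ : BundlePartialAction K α.OrbitFiber) : Prop :=
  (∀ t, μ.base.dom t = α.base.orbit '' β.base.dom t) ∧
  (∀ t, ∀ x ∈ β.base.dom t⁻¹, μ.base.act t (α.base.orbit x) = α.base.orbit (β.base.act t x)) ∧
  (∀ t, ∀ b ∈ β.total.dom t⁻¹, ∀ c : Tot α.OrbitFiber, α.toOrbit c = α.total.orbit b →
    α.toOrbit (μ.total.act t c) = α.total.orbit (β.total.act t b))

end BundlePartialAction

/-! ### C*-partial dynamical systems -/

/-- A partial action of `G` on the C*-algebra `A`: the sets `A_t` are closed two-sided ideals which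
form a continuous family, the maps `γ_t : A_{t⁻¹} → A_t` are *-isomorphisms, and `(t, a) ↦ γ_t(a)`
is continuous on its domain. -/
structure CStarPartialAction (G : Type*) [Group G] [TopologicalSpace G] (A : Type*)
    [NonUnitalCStarAlgebra A] extends PartialAction G A where
  ideal : ∀ t, ∃ I : Submodule ℂ A, (I : Set A) = dom t ∧ IsClosed (I : Set A) ∧
    ∀ a, ∀ b ∈ I, a * b ∈ I ∧ b * a ∈ I
  map_add : ∀ t, ∀ a ∈ dom t⁻¹, ∀ b ∈ dom t⁻¹, act t (a + b) = act t a + act t b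
  map_mul : ∀ t, ∀ a ∈ dom t⁻¹, ∀ b ∈ dom t⁻¹, act t (a * b) = act t a * act t b
  map_smul : ∀ t, ∀ k : ℂ, ∀ a ∈ dom t⁻¹, act t (k • a) = k • act t a
  map_star : ∀ t, ∀ a ∈ dom t⁻¹, act t (star a) = star (act t a)
  family_cont : ∀ U : Set A, IsOpen U → IsOpen {t | (dom t ∩ U).Nonempty}
  act_cont : ContinuousOn (fun p : G × A => act p.1 p.2) {p | p.2 ∈ dom p.1⁻¹}

/-- For a C*-algebra `A` of bounded sections of a bundle, `γ` is the partial action on `A` given by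
the partial action `β` on the bundle: `A_t` is the set of the `f ∈ A` with `‖f(x)‖ = 0` for
`x ∉ X_t`, and for `f ∈ A_{t⁻¹}` one has `γ_t(f)(x) = β_t(f(t⁻¹ ⋆ x))` if `x ∈ X_t` and
`γ_t(f)(x) = 0` otherwise. -/
def CStarPartialAction.IsGivenBy {G : Type*} [Group G] [TopologicalSpace G] {X : Type*}
    [TopologicalSpace X] {B : X → Type*} [∀ x, NonUnitalCStarAlgebra (B x)]
    [TopologicalSpace (Tot B)] {A : NonUnitalStarSubalgebra ℂ (lp B ∞)}
    [IsClosed (A : Set (lp B ∞))] (γ : CStarPartialAction G A) (β : BundlePartialAction G B) :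
    Prop :=
  (∀ t, γ.dom t = {f : A | ∀ x, x ∉ β.base.dom t → ‖(f : lp B ∞) x‖ = 0}) ∧
  ∀ t, ∀ f : A, f ∈ γ.dom t⁻¹ → ∀ x,
    (x ∈ β.base.dom t → (⟨x, (γ.act t f : lp B ∞) x⟩ : Tot B) =
      β.total.act t ⟨β.base.act t⁻¹ x, (f : lp B ∞) (β.base.act t⁻¹ x)⟩) ∧
    (x ∉ β.base.dom t → (γ.act t f : lp B ∞) x = 0)

/-! The core is that, when `α` is free and proper, `B` is the pullback of `B/H` along `X → X/H`. By
freeness a point `b` is determined by its projection `p(b)` and its orbit `Hb`. By properness the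
topology of `B` is induced by these two maps (`exists_nhds_proj_orbitMk`): the group element that
carries one point near `x` to another point near `x` must be close to `1`
(`eventually_mem_of_act_eq`).

Two consequences follow. The fiberwise operations of `B` descend continuously to `B/H`, which is
therefore an upper semicontinuous C*-bundle (`isUSCCStarBundle_orbitFiber`). Every section in
`C_0(B/H)` lifts to a continuous equivariant section of `B` (`surjective_indHom`). As `‖f‖` is
constant on orbits for equivariant `f`, `Ind` is an isometric *-isomorphism onto the complete
algebra `C_0(B/H)`, so `Ind_0(B, α)` is closed.

The dynamics is obtained downstairs. Since `β` commutes with `α`, it descends to a partial action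
`μ` on `B/H`. Over a locally compact Hausdorff base every partial action on a bundle yields a
C*-partial dynamical system on `C_0`: sections are moved and extended by zero (`push`), and
continuity is reduced to sections with compact support by a cutoff (`cZeroCStar`). Here `X/H` is
Hausdorff because `α` is proper. The system for `μ` is transported back along `Ind`, and
`isGivenBy_of_ind` identifies the result with the formula in terms of `β`. -/

namespace PartialAction

variable {G H K X : Type*} [Group G] [Group H] [Group K]

lemma act_inv_mem (a : PartialAction G X) {t : G} {x : X} (h : x ∈ a.dom t) :
    a.act t⁻¹ x ∈ a.dom t⁻¹ := a.act_mem (by simpa using h)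

lemma act_act_inv (a : PartialAction G X) {t : G} {x : X} (h : x ∈ a.dom t) :
    a.act t (a.act t⁻¹ x) = x := by
  simpa using a.act_inv_act (t := t⁻¹) (by simpa using h)

lemma orbit_eq_iff (a : PartialAction G X) {x y : X} :
    a.orbit x = a.orbit y ↔ ∃ t, x ∈ a.dom t⁻¹ ∧ a.act t x = y := Quotient.eq

lemma orbit_act (a : PartialAction G X) {t : G} {x : X} (h : x ∈ a.dom t⁻¹) :
    a.orbit (a.act t x) = a.orbit x := (a.orbit_eq_iff.2 ⟨t, h, rfl⟩).symm

/-! ### Topology of the orbit space. -/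

section Topological

variable [TopologicalSpace G] [TopologicalSpace X]

lemma IsCont.isOpen_dom {a : PartialAction G X} (ha : a.IsCont) (t : G) : IsOpen (a.dom t) := by
  have : Continuous fun x : X => (t⁻¹, x) := by fun_prop
  convert ha.1.preimage this using 1
  ext x
  simp [graphDom]

lemma IsCont.continuousAt {a : PartialAction G X} (ha : a.IsCont) {t : G} {x : X}
    (hx : x ∈ a.dom t⁻¹) : ContinuousAt (fun p : G × X => a.act p.1 p.2) (t, x) :=
  ha.2.continuousAt (ha.1.mem_nhds hx)

lemma IsCont.continuousOn_act {a : PartialAction G X} (ha : a.IsCont) (t : G) :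
    ContinuousOn (a.act t) (a.dom t⁻¹) := fun x hx =>
  ((ha.continuousAt hx).comp (f := fun x : X => (t, x)) (by fun_prop)).continuousWithinAt

/-- The saturation of an open `U` is the union over `t` of the preimages of `U` under `a.act t` in
the open sets `a.dom t⁻¹`. -/
lemma IsCont.isOpenMap_orbit {a : PartialAction G X} (ha : a.IsCont) : IsOpenMap a.orbit := by
  intro U hU
  refine isOpen_coinduced.2 ?_
  change IsOpen ((Quotient.mk a.orbitSetoid) ⁻¹' (a.orbit '' U))
  have h : (Quotient.mk a.orbitSetoid) ⁻¹' (a.orbit '' U) =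
      ⋃ t, a.dom t⁻¹ ∩ a.act t ⁻¹' U := by
    ext x
    simp only [mem_preimage, mem_image, mem_iUnion, mem_inter_iff]
    constructor
    · rintro ⟨y, hy, he⟩
      obtain ⟨t, ht, rfl⟩ := a.orbit_eq_iff.1 he.symm
      exact ⟨t, ht, hy⟩
    · rintro ⟨t, ht, hy⟩
      exact ⟨_, hy, a.orbit_act ht⟩
  rw [h]
  exact isOpen_iUnion fun t => (ha.continuousOn_act t).isOpen_inter_preimage (ha.isOpen_dom _) hU

lemma IsCont.isOpenQuotientMap_orbit {a : PartialAction G X} (ha : a.IsCont) :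
    IsOpenQuotientMap a.orbit :=
  ⟨Quotient.mk_surjective, continuous_quotient_mk', ha.isOpenMap_orbit⟩

variable [LocallyCompactSpace X] [T2Space X]

/-- The orbit space of a proper partial action is Hausdorff. -/
lemma IsCont.t2Space_orbitSpace {a : PartialAction G X} (ha : a.IsCont) (hp : a.IsProper) :
    T2Space a.OrbitSpace := by
  rw [t2Space_iff_of_isOpenQuotientMap ha.isOpenQuotientMap_orbit, ← isOpen_compl_iff,
    isOpen_iff_mem_nhds]
  rintro ⟨x, y⟩ hxy
  obtain ⟨C, hC, hxC⟩ := exists_compact_mem_nhds (x, y)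
  have hcont : ContinuousOn (fun p : G × X => (p.2, a.act p.1 p.2)) a.graphDom :=
    continuousOn_snd.prodMk ha.2
  -- By properness, the part of the orbit relation inside the compact neighborhood `C` is the image
  -- of a compact set, so it is closed.
  have himg := ((hp C hC).image_of_continuousOn (hcont.mono fun p hp => hp.1)).isClosed
  have hmem : (x, y) ∈ ((fun p : G × X => (p.2, a.act p.1 p.2)) ''
      {p : G × X | p ∈ a.graphDom ∧ (p.2, a.act p.1 p.2) ∈ C})ᶜ := by
    rintro ⟨⟨t, z⟩, ⟨hz, -⟩, he⟩
    obtain ⟨rfl, rfl⟩ := Prod.mk.inj he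
    exact hxy (a.orbit_act hz).symm
  filter_upwards [himg.isOpen_compl.mem_nhds hmem, hxC] with ⟨x', y'⟩ h1 h2 h3
  obtain ⟨t, ht, he⟩ := a.orbit_eq_iff.1 h3
  obtain rfl : a.act t x' = y' := he
  exact h1 ⟨(t, x'), ⟨ht, h2⟩, rfl⟩

/-- Continuity at the diagonal of the translation function of a free and proper partial action. -/
lemma IsCont.eventually_mem_of_act_eq {a : PartialAction G X} (ha : a.IsCont) (hf : a.IsFree)
    (hp : a.IsProper) (x : X) {N : Set G} (hN : N ∈ 𝓝 1) :
    ∀ᶠ p : X × X in 𝓝 (x, x), ∀ t, p.1 ∈ a.dom t⁻¹ → a.act t p.1 = p.2 → t ∈ N := by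
  obtain ⟨C, hC, hxC⟩ := exists_compact_mem_nhds (x, x)
  have hcont : ContinuousOn (fun p : G × X => (p.2, a.act p.1 p.2)) a.graphDom :=
    continuousOn_snd.prodMk ha.2
  -- Only pairs whose group element is outside the interior of `N` are kept. The image of this
  -- compact set is closed, and it misses `(x, x)` because only `1` fixes `x`.
  have hcpt : IsCompact ({p : G × X | p ∈ a.graphDom ∧ (p.2, a.act p.1 p.2) ∈ C} \
      (interior N ×ˢ univ)) := (hp C hC).diff (isOpen_interior.prod isOpen_univ)
  have himg := (hcpt.image_of_continuousOn (hcont.mono fun p hp => hp.1.1)).isClosed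
  have hmem : (x, x) ∈ ((fun p : G × X => (p.2, a.act p.1 p.2)) ''
      ({p : G × X | p ∈ a.graphDom ∧ (p.2, a.act p.1 p.2) ∈ C} \ (interior N ×ˢ univ)))ᶜ := by
    rintro ⟨⟨t, z⟩, ⟨⟨hz, -⟩, hn⟩, he⟩
    obtain ⟨rfl, h1⟩ := Prod.mk.inj he
    refine hn ⟨?_, mem_univ _⟩
    rw [hf _ t hz h1]
    exact mem_interior_iff_mem_nhds.2 hN
  filter_upwards [himg.isOpen_compl.mem_nhds hmem, hxC] with ⟨x', y'⟩ h1 h2 t ht he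
  obtain rfl : a.act t x' = y' := he
  by_contra hn
  exact h1 ⟨(t, x'), ⟨⟨ht, h2⟩, fun h => hn (interior_subset h.1)⟩, rfl⟩

end Topological

/-! ### Commuting partial actions -/

namespace Commutes

variable {a : PartialAction H X} {b : PartialAction K X}

/-- The set identity in `Commutes` enters only through this lemma and the next: each action leaves
the domains of the other invariant. -/
lemma act_left_mem (h : a.Commutes b) {s : H} {t : K} {x : X} (hs : x ∈ a.dom s⁻¹)
    (ht : x ∈ b.dom t) : a.act s x ∈ b.dom t := by
  have h1 : a.act s x ∈ a.act s '' (a.dom s⁻¹ ∩ b.dom t) := mem_image_of_mem _ ⟨hs, ht⟩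
  rw [(h s t).1] at h1
  obtain ⟨y, hy, he⟩ := h1
  rw [← he]
  exact b.act_mem hy.1

lemma act_right_mem (h : a.Commutes b) {s : H} {t : K} {x : X} (hs : x ∈ a.dom s)
    (ht : x ∈ b.dom t⁻¹) : b.act t x ∈ a.dom s := by
  have h1 : b.act t x ∈ b.act t '' (b.dom t⁻¹ ∩ a.dom s) := mem_image_of_mem _ ⟨ht, hs⟩
  rw [← (h s t).1] at h1
  obtain ⟨y, hy, he⟩ := h1
  rw [← he]
  exact a.act_mem hy.1

lemma act_act (h : a.Commutes b) {s : H} {t : K} {x : X} (hs : x ∈ a.dom s⁻¹)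
    (ht : x ∈ b.dom t⁻¹) : a.act s (b.act t x) = b.act t (a.act s x) :=
  (h s t).2 x ⟨_, ⟨a.act_mem hs, h.act_left_mem hs ht⟩, a.act_inv_act hs⟩

lemma mem_dom_iff (h : a.Commutes b) {t : K} {x y : X} (hxy : a.orbit x = a.orbit y) :
    x ∈ b.dom t ↔ y ∈ b.dom t := by
  obtain ⟨s, hs, rfl⟩ := a.orbit_eq_iff.1 hxy
  refine ⟨h.act_left_mem hs, fun hy => ?_⟩
  have := h.act_left_mem (s := s⁻¹) (by simpa using a.act_mem hs) hy
  rwa [a.act_inv_act hs] at this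

/-- The domain `b.dom t` is a union of `a`-orbits, so membership can be tested on any
representative. -/
lemma orbit_mem_image_iff (h : a.Commutes b) {t : K} {x : X} :
    a.orbit x ∈ a.orbit '' b.dom t ↔ x ∈ b.dom t :=
  ⟨fun ⟨_, hy, he⟩ => (h.mem_dom_iff he).1 hy, mem_image_of_mem _⟩

lemma orbit_act_congr (h : a.Commutes b) {t : K} {x y : X} (hxy : a.orbit x = a.orbit y)
    (hx : x ∈ b.dom t⁻¹) : a.orbit (b.act t x) = a.orbit (b.act t y) := by
  obtain ⟨s, hs, rfl⟩ := a.orbit_eq_iff.1 hxy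
  exact a.orbit_eq_iff.2 ⟨s, h.act_right_mem hs hx, h.act_act hs hx⟩

/-- The partial action induced on the orbit space by a commuting partial action. -/
noncomputable def quotient (h : a.Commutes b) : PartialAction K a.OrbitSpace where
  dom t := a.orbit '' b.dom t
  -- On the domain the choice of representative does not matter, by `orbit_act_congr`.
  act t z := a.orbit (b.act t z.out)
  dom_one := by
    rw [b.dom_one, image_univ]
    exact Quotient.mk_surjective.range_eq
  act_one z := by
    rw [b.act_one]
    exact z.out_eq
  bijOn t := by
    -- Quantified over `t` because surjectivity uses it at `t⁻¹`.
    have hm : ∀ (t : K), ∀ z ∈ a.orbit '' b.dom t⁻¹,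
        a.orbit (b.act t z.out) ∈ a.orbit '' b.dom t ∧
          a.orbit (b.act t⁻¹ (a.orbit (b.act t z.out)).out) = z := by
      intro t z hz
      rw [← z.out_eq] at hz
      have hx := h.orbit_mem_image_iff.1 hz
      refine ⟨mem_image_of_mem _ (b.act_mem hx), ?_⟩
      rw [← h.orbit_act_congr (Quotient.out_eq _).symm (by simpa using b.act_mem hx),
        b.act_inv_act hx]
      exact z.out_eq
    refine ⟨fun z hz => (hm t z hz).1, fun z hz w hw he => ?_, fun z hz => ?_⟩
    · rw [← (hm t z hz).2, ← (hm t w hw).2]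
      exact congrArg (fun z : a.OrbitSpace => a.orbit (b.act t⁻¹ z.out)) he
    · have := hm t⁻¹ z (by simpa using hz)
      rw [inv_inv] at this
      exact ⟨_, this⟩
  comp s t z hz hz' := by
    rw [← z.out_eq] at hz
    have hx := h.orbit_mem_image_iff.1 hz
    have hy := h.orbit_mem_image_iff.1 hz'
    obtain ⟨h1, h2⟩ := b.comp s t _ hx hy
    refine ⟨⟨_, h1, z.out_eq⟩, ?_⟩
    rw [h2]
    exact h.orbit_act_congr (Quotient.out_eq _).symm hy

lemma orbit_mem_quotient_dom (h : a.Commutes b) {t : K} {x : X} :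
    a.orbit x ∈ h.quotient.dom t ↔ x ∈ b.dom t := h.orbit_mem_image_iff

lemma quotient_act (h : a.Commutes b) {t : K} {x : X} (hx : x ∈ b.dom t⁻¹) :
    h.quotient.act t (a.orbit x) = a.orbit (b.act t x) :=
  (h.orbit_act_congr (Quotient.out_eq _).symm hx).symm

/-- The product of the identity of `K` with the orbit map is an open quotient map, so openness of
the domain and continuity on it descend. -/
lemma isCont_quotient [TopologicalSpace H] [TopologicalSpace K] [TopologicalSpace X]
    (h : a.Commutes b) (ha : a.IsCont) (hb : b.IsCont) : h.quotient.IsCont := by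
  have hq : IsOpenQuotientMap (Prod.map id a.orbit : K × X → K × a.OrbitSpace) :=
    IsOpenQuotientMap.id.prodMap ha.isOpenQuotientMap_orbit
  have hpre : Prod.map id a.orbit ⁻¹' h.quotient.graphDom = b.graphDom := by
    ext p
    exact h.orbit_mem_quotient_dom
  refine ⟨by rw [← hq.isQuotientMap.isOpen_preimage, hpre]; exact hb.1, ?_⟩
  intro q hq'
  obtain ⟨⟨t, x⟩, rfl⟩ := hq.surjective q
  have hx : x ∈ b.dom t⁻¹ := h.orbit_mem_quotient_dom.1 hq'
  refine ContinuousAt.continuousWithinAt ((hq.continuousAt_comp_iff).1 ?_)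
  refine ((continuous_quotient_mk'.continuousAt (x := b.act t x)).comp
    (f := fun p : K × X => b.act p.1 p.2) (hb.continuousAt hx)).congr ?_
  filter_upwards [hb.1.mem_nhds (show (t, x) ∈ b.graphDom from hx)] with p hp
  exact (h.quotient_act hp).symm

end Commutes

end PartialAction

/-! ### Neighborhoods in the total space of a bundle -/

section Bundle

variable {X : Type*} {B : X → Type*}

lemma tot_snd_eq {x : X} {b c : B x} (h : (⟨x, b⟩ : Tot B) = ⟨x, c⟩) : b = c := by
  simpa using h

lemma continuous_fiberPair_iff [TopologicalSpace (Tot B)] {F : (Σ x, B x × B x) → Tot B} :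
    Continuous[fiberPairTopology B, inferInstance] F ↔ ∀ x, ∀ b c : B x, ∀ W ∈ 𝓝 (F ⟨x, b, c⟩),
      ∃ U ∈ 𝓝 (⟨x, b⟩ : Tot B), ∃ V ∈ 𝓝 (⟨x, c⟩ : Tot B), ∀ y, ∀ b' c' : B y,
        (⟨y, b'⟩ : Tot B) ∈ U → (⟨y, c'⟩ : Tot B) ∈ V → F ⟨y, b', c'⟩ ∈ W := by
  let _ := fiberPairTopology B
  rw [continuous_iff_continuousAt]
  constructor
  · intro h x b c W hW
    have h1 := h ⟨x, b, c⟩ hW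
    rw [nhds_induced, Filter.mem_map, mem_comap] at h1
    obtain ⟨T, hT, hTW⟩ := h1
    obtain ⟨U, hU, V, hV, hUV⟩ := mem_nhds_prod_iff.1 hT
    exact ⟨U, hU, V, hV, fun y b' c' h1 h2 =>
      hTW (show (⟨y, b', c'⟩ : Σ x, B x × B x) ∈ _ from hUV ⟨h1, h2⟩)⟩
  · rintro h ⟨x, b, c⟩ W hW
    obtain ⟨U, hU, V, hV, hUV⟩ := h x b c W hW
    rw [nhds_induced, Filter.mem_map, mem_comap]
    exact ⟨U ×ˢ V, prod_mem_nhds hU hV, fun q hq => hUV q.1 q.2.1 q.2.2 hq.1 hq.2⟩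

variable [TopologicalSpace X] [∀ x, NonUnitalCStarAlgebra (B x)] [TopologicalSpace (Tot B)]

namespace IsUSCCStarBundle

/-- The axiom `le_nhds_zero` is applied to the largest filter satisfying its hypotheses, whose basic
sets are tubes. -/
lemma exists_tube_zero (hB : IsUSCCStarBundle B) {x : X} {W : Set (Tot B)}
    (hW : W ∈ 𝓝 (⟨x, 0⟩ : Tot B)) : ∃ V ∈ 𝓝 x, ∃ δ : ℝ, 0 < δ ∧
      ∀ c : Tot B, c.proj ∈ V → ‖c.snd‖ < δ → c ∈ W := by
  have h := hB.le_nhds_zero x (comap (fun b : Tot B => b.proj) (𝓝 x) ⊓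
    comap (fun b : Tot B => ‖b.snd‖) (𝓝 0)) (tendsto_comap.mono_left inf_le_left)
    (tendsto_comap.mono_left inf_le_right) hW
  obtain ⟨S, hS, T, hT, rfl⟩ := mem_inf_iff.1 h
  obtain ⟨V, hV, hVS⟩ := mem_comap.1 hS
  obtain ⟨N, hN, hNT⟩ := mem_comap.1 hT
  obtain ⟨δ, hδ, hδN⟩ := Metric.mem_nhds_iff.1 hN
  exact ⟨V, hV, δ, hδ, fun c h1 h2 => ⟨hVS h1, hNT (hδN (by simpa using h2))⟩⟩

/-- Points of a fiber that are close in norm to points near `b` are near `b`. -/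
lemma exists_norm_sub_lt (hB : IsUSCCStarBundle B) {b : Tot B} {W : Set (Tot B)} (hW : W ∈ 𝓝 b) :
    ∃ W' ∈ 𝓝 b, ∃ δ : ℝ, 0 < δ ∧ ∀ x, ∀ c d : B x, (⟨x, c⟩ : Tot B) ∈ W' → ‖d - c‖ < δ →
      (⟨x, d⟩ : Tot B) ∈ W := by
  obtain ⟨x, b⟩ := b
  -- Continuity of addition at `(b, 0)`, for later use on `d = c + (d - c)` with `d - c` in a tube
  -- around zero.
  obtain ⟨U, hU, V, hV, h⟩ := continuous_fiberPair_iff.1 hB.continuous_add x b 0 W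
    (by simpa using hW)
  obtain ⟨N, hN, δ, hδ, hδV⟩ := hB.exists_tube_zero hV
  refine ⟨U ∩ (fun b : Tot B => b.proj) ⁻¹' N,
    inter_mem hU (hB.continuous_proj.continuousAt.preimage_mem_nhds hN), δ, hδ, ?_⟩
  rintro y c d ⟨h1, h2⟩ h3
  have := h y c (d - c) h1 (hδV _ h2 h3)
  simpa using this

lemma eventually_norm_lt (hB : IsUSCCStarBundle B) {b : Tot B} {ε : ℝ} (h : ‖b.snd‖ < ε) :
    ∀ᶠ c : Tot B in 𝓝 b, ‖c.snd‖ < ε :=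
  (hB.isOpen_norm_lt ε ((norm_nonneg _).trans_lt h)).mem_nhds h

lemma continuousAt_sub (hB : IsUSCCStarBundle B) {Y : Type*} [TopologicalSpace Y] {g : Y → X}
    {f f' : ∀ y, B (g y)} {y : Y} (hf : ContinuousAt (fun y => (⟨g y, f y⟩ : Tot B)) y)
    (hf' : ContinuousAt (fun y => (⟨g y, f' y⟩ : Tot B)) y) :
    ContinuousAt (fun y => (⟨g y, f y - f' y⟩ : Tot B)) y := by
  intro W hW
  have hneg : ContinuousAt (fun y => (⟨g y, (-1 : ℂ) • f' y⟩ : Tot B)) y :=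
    (hB.continuous_smul (-1)).continuousAt.comp
      (f := fun y => (⟨g y, f' y⟩ : Tot B)) hf'
  obtain ⟨U, hU, V, hV, h⟩ := continuous_fiberPair_iff.1 hB.continuous_add (g y) (f y)
    ((-1 : ℂ) • f' y) W (by simpa [sub_eq_add_neg] using hW)
  refine Filter.mem_map.2 ?_
  filter_upwards [hf hU, hneg hV] with z h1 h2
  have := h (g z) _ _ h1 h2
  simpa [sub_eq_add_neg] using this

end IsUSCCStarBundle

/-- Closeness is used twice: from `f x` to `g x` at the base point, then from `g y` back to `f y` at
nearby points. -/
lemma ContSection.of_uniform (hB : IsUSCCStarBundle B) {f : ∀ x, B x}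
    (h : ∀ ε : ℝ, 0 < ε → ∃ g, ContSection g ∧ ∀ x, ‖f x - g x‖ < ε) : ContSection f := by
  refine continuous_iff_continuousAt.2 fun x W hW => ?_
  obtain ⟨W', hW', δ, hδ, h1⟩ := hB.exists_norm_sub_lt hW
  obtain ⟨W'', hW'', δ', hδ', h2⟩ := hB.exists_norm_sub_lt (interior_mem_nhds.2 hW')
  obtain ⟨g, hg, hfg⟩ := h (min δ δ') (lt_min hδ hδ')
  have hgx : (⟨x, g x⟩ : Tot B) ∈ interior W' :=
    h2 x (f x) (g x) (mem_of_mem_nhds hW'')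
      (by rw [norm_sub_rev]; exact (hfg x).trans_le (min_le_right _ _))
  refine Filter.mem_map.2 ?_
  filter_upwards [hg.continuousAt (isOpen_interior.mem_nhds hgx)] with y hy
  exact h1 y (g y) (f y) (interior_subset hy) ((hfg y).trans_le (min_le_left _ _))

/-- The bundle axioms give continuity only for a fixed scalar. The scalar is frozen at `k x`, and
the error `(k y - k x) • f y` is small since `f` is bounded. -/
lemma ContSection.smul_fun (hB : IsUSCCStarBundle B) {f : ∀ x, B x} (hf : ContSection f) {C : ℝ}
    (hC : ∀ x, ‖f x‖ ≤ C) {k : X → ℂ} (hk : Continuous k) :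
    ContSection (fun x => k x • f x) := by
  refine continuous_iff_continuousAt.2 fun x W hW => ?_
  obtain ⟨W', hW', δ, hδ, h⟩ := hB.exists_norm_sub_lt hW
  have h1 : ∀ᶠ y in 𝓝 x, ‖k y - k x‖ * C < δ := by
    have : Continuous fun y => ‖k y - k x‖ * C := by fun_prop
    exact this.continuousAt.eventually_lt continuousAt_const (by simpa using hδ)
  refine Filter.mem_map.2 ?_
  filter_upwards [(hf.smul hB (k x)).continuousAt hW', h1] with y h2 h3
  refine h y _ _ h2 ?_
  change ‖k y • f y - k x • f y‖ < δ
  rw [← sub_smul, norm_smul]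
  exact (mul_le_mul_of_nonneg_left (hC y) (norm_nonneg _)).trans_lt h3

lemma isClosed_cZero (hB : IsUSCCStarBundle B) : IsClosed (cZero hB : Set (lp B ∞)) := by
  refine isClosed_of_closure_subset fun f hf => ?_
  have h : ∀ ε : ℝ, 0 < ε → ∃ g ∈ cZero hB, ∀ x, ‖f x - g x‖ < ε := by
    intro ε hε
    obtain ⟨g, hg, hfg⟩ := Metric.mem_closure_iff.1 hf ε hε
    refine ⟨g, hg, fun x => ?_⟩
    rw [dist_eq_norm] at hfg
    exact (lp.norm_apply_le_norm ENNReal.top_ne_zero (f - g) x).trans_lt hfg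
  have hc : ContSection (⇑f) := ContSection.of_uniform hB fun ε hε => by
    obtain ⟨g, hg, hfg⟩ := h ε hε
    exact ⟨g, hg.1, hfg⟩
  refine ⟨hc, fun ε hε => ?_⟩
  obtain ⟨g, hg, hfg⟩ := h (ε / 2) (half_pos hε)
  -- As `f` and `g` differ by less than `ε / 2`, the inequality `ε ≤ ‖f x‖` forces `ε / 2 ≤ ‖g x‖`.
  refine (hg.2 (ε / 2) (half_pos hε)).of_isClosed_subset (hc.isClosed_le hB hε) fun x hx => ?_
  have h1 := norm_le_norm_add_norm_sub' (f x) (g x)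
  have h2 := hfg x
  have h3 : ε ≤ ‖f x‖ := hx
  change ε / 2 ≤ ‖g x‖
  linarith

end Bundle

/-! ### The action on sections induced by a partial action on a bundle -/

namespace BundlePartialAction

variable {G : Type*} [Group G] [TopologicalSpace G] {X : Type*} [TopologicalSpace X]
  {B : X → Type*} [∀ x, NonUnitalCStarAlgebra (B x)] [TopologicalSpace (Tot B)]
  (β : BundlePartialAction G B)

lemma mem_total_dom {t : G} {b : Tot B} : b ∈ β.total.dom t ↔ b.proj ∈ β.base.dom t := by
  rw [← β.preimage_dom]
  rfl

lemma proj_act {t : G} {b : Tot B} (h : b.proj ∈ β.base.dom t⁻¹) :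
    (β.total.act t b).proj = β.base.act t b.proj :=
  (β.proj_morphism.2.2 t b (β.mem_total_dom.2 h)).symm

/-- The image point lies over `t ⋆ (t⁻¹ ⋆ x)`, which equals `x` only propositionally; the
existential form avoids a cast between fibers. -/
lemma exists_push (t : G) (f : ∀ x, B x) {x : X} (hx : x ∈ β.base.dom t) :
    ∃ b : B x, (⟨x, b⟩ : Tot B) =
      β.total.act t ⟨β.base.act t⁻¹ x, f (β.base.act t⁻¹ x)⟩ := by
  have h := β.proj_act (b := ⟨β.base.act t⁻¹ x, f (β.base.act t⁻¹ x)⟩) (β.base.act_inv_mem hx)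
  rw [show β.base.act t (β.base.act t⁻¹ x) = x from β.base.act_act_inv hx] at h
  revert h
  generalize β.total.act t _ = c
  rintro rfl
  exact ⟨c.snd, rfl⟩

open Classical in
/-- The section `x ↦ β_t(f(t⁻¹ ⋆ x))` on `X_t`, extended by zero. -/
noncomputable def push (t : G) (f : ∀ x, B x) (x : X) : B x :=
  if hx : x ∈ β.base.dom t then (β.exists_push t f hx).choose else 0

lemma push_of_mem (t : G) (f : ∀ x, B x) {x : X} (hx : x ∈ β.base.dom t) :
    (⟨x, β.push t f x⟩ : Tot B) =
      β.total.act t ⟨β.base.act t⁻¹ x, f (β.base.act t⁻¹ x)⟩ := by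
  rw [push, dif_pos hx]
  exact (β.exists_push t f hx).choose_spec

lemma push_of_notMem (t : G) (f : ∀ x, B x) {x : X} (hx : x ∉ β.base.dom t) :
    β.push t f x = 0 := dif_neg hx

lemma push_act (t : G) (f : ∀ x, B x) {x : X} (hx : x ∈ β.base.dom t⁻¹) :
    (⟨β.base.act t x, β.push t f (β.base.act t x)⟩ : Tot B) = β.total.act t ⟨x, f x⟩ := by
  rw [β.push_of_mem t f (β.base.act_mem hx), β.base.act_inv_act hx]

/-- The point `y` and the homomorphism `φ` serve all sections at once, so algebraic identities for
`push` reduce to those of `φ`. -/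
lemma exists_push_hom {t : G} {x : X} (hx : x ∈ β.base.dom t) :
    ∃ y ∈ β.base.dom t⁻¹, ∃ φ : B y →⋆ₙₐ[ℂ] B x, ∀ f, β.push t f x = φ (f y) := by
  obtain ⟨y, hy, rfl⟩ := (β.base.bijOn t).surjOn hx
  obtain ⟨φ, hφ⟩ := β.fiber_hom t y hy
  exact ⟨y, hy, φ, fun f => tot_snd_eq ((β.push_act t f hy).trans (hφ _))⟩

lemma push_add (t : G) (f g : ∀ x, B x) : β.push t (f + g) = β.push t f + β.push t g := by
  ext x
  by_cases hx : x ∈ β.base.dom t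
  · obtain ⟨y, -, φ, hφ⟩ := β.exists_push_hom hx
    simp [hφ]
  · simp [β.push_of_notMem t _ hx]

lemma push_sub (t : G) (f g : ∀ x, B x) : β.push t (f - g) = β.push t f - β.push t g := by
  ext x
  by_cases hx : x ∈ β.base.dom t
  · obtain ⟨y, -, φ, hφ⟩ := β.exists_push_hom hx
    simp [hφ]
  · simp [β.push_of_notMem t _ hx]

lemma push_mul (t : G) (f g : ∀ x, B x) : β.push t (f * g) = β.push t f * β.push t g := by
  ext x
  by_cases hx : x ∈ β.base.dom t
  · obtain ⟨y, -, φ, hφ⟩ := β.exists_push_hom hx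
    simp [hφ]
  · simp [β.push_of_notMem t _ hx]

lemma push_smul (t : G) (k : ℂ) (f : ∀ x, B x) : β.push t (k • f) = k • β.push t f := by
  ext x
  by_cases hx : x ∈ β.base.dom t
  · obtain ⟨y, -, φ, hφ⟩ := β.exists_push_hom hx
    simp [hφ, map_smul]
  · simp [β.push_of_notMem t _ hx]

lemma push_star (t : G) (f : ∀ x, B x) : β.push t (star f) = star (β.push t f) := by
  ext x
  by_cases hx : x ∈ β.base.dom t
  · obtain ⟨y, -, φ, hφ⟩ := β.exists_push_hom hx
    simp [hφ, map_star]
  · simp [β.push_of_notMem t _ hx]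

lemma norm_push_act (t : G) (f : ∀ x, B x) {x : X} (hx : x ∈ β.base.dom t⁻¹) :
    ‖β.push t f (β.base.act t x)‖ = ‖f x‖ := by
  rw [← β.norm_act hx (f x), ← β.push_act t f hx]

lemma norm_push_le (t : G) {f : ∀ x, B x} {C : ℝ} (hC : 0 ≤ C) (hf : ∀ x, ‖f x‖ ≤ C) (x : X) :
    ‖β.push t f x‖ ≤ C := by
  by_cases hx : x ∈ β.base.dom t
  · obtain ⟨y, hy, rfl⟩ := (β.base.bijOn t).surjOn hx
    rw [β.norm_push_act t f hy]
    exact hf y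
  · simpa [β.push_of_notMem t _ hx] using hC

lemma push_one (f : ∀ x, B x) : β.push 1 f = f := by
  ext x
  have h := β.push_act 1 f (x := x) (by simp [β.base.dom_one])
  rw [β.base.act_one, β.total.act_one] at h
  exact tot_snd_eq h

lemma mem_of_push_ne_zero {s : G} {f : ∀ x, B x} {x : X} (h : β.push s f x ≠ 0) :
    ∃ y ∈ β.base.dom s⁻¹, f y ≠ 0 ∧ β.base.act s y = x := by
  have hx : x ∈ β.base.dom s := by
    by_contra hx
    exact h (β.push_of_notMem s f hx)
  obtain ⟨y, hy, rfl⟩ := (β.base.bijOn s).surjOn hx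
  refine ⟨y, hy, fun h0 => h ?_, rfl⟩
  rw [← norm_eq_zero, β.norm_push_act s f hy, h0, norm_zero]

lemma push_mul_act {s t : G} (f : ∀ x, B x) {x : X} (hx : x ∈ β.base.dom t⁻¹)
    (hx' : β.base.act t x ∈ β.base.dom s⁻¹) :
    β.push s (β.push t f) (β.base.act (s * t) x) = β.push (s * t) f (β.base.act (s * t) x) := by
  obtain ⟨h1, h2⟩ := β.base.comp s t x hx hx'
  refine tot_snd_eq ?_
  have h3 := β.push_act s (β.push t f) hx'
  rw [← h2, β.push_act t f hx] at h3
  rw [β.push_act (s * t) f h1, h3]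
  refine ((β.total.comp s t ⟨x, f x⟩ (β.mem_total_dom.2 hx) ?_).2).symm
  rw [β.mem_total_dom, β.proj_act (b := ⟨x, f x⟩) hx]
  exact hx'

/-- By `hf'`, wherever `f x ≠ 0` the point `t ⋆ x` can be moved on by `s`. Hence the two sides agree
at every point where either is nonzero. -/
lemma push_push {s t : G} {f : ∀ x, B x} (hf : ∀ x ∉ β.base.dom t⁻¹, f x = 0)
    (hf' : ∀ x ∉ β.base.dom s⁻¹, β.push t f x = 0) :
    β.push s (β.push t f) = β.push (s * t) f := by
  have key : ∀ x, x ∈ β.base.dom t⁻¹ → f x ≠ 0 → β.base.act t x ∈ β.base.dom s⁻¹ := by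
    intro x hx h0
    by_contra hx'
    have := hf' _ hx'
    rw [← norm_eq_zero, β.norm_push_act t f hx, norm_eq_zero] at this
    exact h0 this
  ext y
  by_cases h : β.push s (β.push t f) y = 0
  · by_contra hne
    have h' : β.push (s * t) f y ≠ 0 := fun h' => hne (h.trans h'.symm)
    obtain ⟨x, -, h0, rfl⟩ := β.mem_of_push_ne_zero h'
    have hx : x ∈ β.base.dom t⁻¹ := by
      by_contra hx
      exact h0 (hf x hx)
    exact hne (β.push_mul_act f hx (key x hx h0))
  · obtain ⟨w, -, hw0, rfl⟩ := β.mem_of_push_ne_zero h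
    obtain ⟨x, hx, h0, rfl⟩ := β.mem_of_push_ne_zero hw0
    rw [← (β.base.comp s t x hx (key x hx h0)).2]
    exact β.push_mul_act f hx (key x hx h0)

lemma push_inv_push {t : G} {f : ∀ x, B x} (hf : ∀ x ∉ β.base.dom t⁻¹, f x = 0) :
    β.push t⁻¹ (β.push t f) = f := by
  rw [β.push_push hf fun x hx => β.push_of_notMem t f (by simpa using hx), inv_mul_cancel,
    β.push_one]

lemma setOf_le_norm_push {t : G} {f : ∀ x, B x} (hf : ∀ x ∉ β.base.dom t⁻¹, f x = 0) {ε : ℝ}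
    (hε : 0 < ε) : {x | ε ≤ ‖β.push t f x‖} = β.base.act t '' {x | ε ≤ ‖f x‖} := by
  ext x
  constructor
  · intro h
    have h0 : β.push t f x ≠ 0 := norm_pos_iff.1 (hε.trans_le h)
    obtain ⟨y, hy, -, rfl⟩ := β.mem_of_push_ne_zero h0
    exact ⟨y, h.trans_eq (β.norm_push_act t f hy), rfl⟩
  · rintro ⟨y, hy, rfl⟩
    have hy' : y ∈ β.base.dom t⁻¹ := by
      by_contra hcon
      have : ε ≤ ‖f y‖ := hy
      rw [hf y hcon, norm_zero] at this
      exact absurd this (not_le.2 hε)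
    change ε ≤ _
    rw [β.norm_push_act t f hy']
    exact hy

lemma vanishesAtInfinity_push {t : G} {f : ∀ x, B x} (hf : ∀ x ∉ β.base.dom t⁻¹, f x = 0)
    (hv : VanishesAtInfinity f) : VanishesAtInfinity (β.push t f) := by
  intro ε hε
  rw [β.setOf_le_norm_push hf hε]
  refine (hv ε hε).image_of_continuousOn ((β.base_cont.continuousOn_act t).mono fun x hx => ?_)
  by_contra hcon
  have : ε ≤ ‖f x‖ := hx
  rw [hf x hcon, norm_zero] at this
  exact absurd this (not_le.2 hε)

/-- Continuity is joint in the group element and the point because norm continuity in `t` is deduced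
from it by a tube argument. -/
lemma continuousAt_push [IsTopologicalGroup G] {f : ∀ x, B x} (hf : ContSection f) {t : G} {x : X}
    (hx : x ∈ β.base.dom t) :
    ContinuousAt (fun p : G × X => (⟨p.2, β.push p.1 f p.2⟩ : Tot B)) (t, x) := by
  have hinv : Continuous fun p : G × X => (p.1⁻¹, p.2) := by fun_prop
  have hx' : x ∈ β.base.dom (t⁻¹)⁻¹ := by simpa using hx
  have h1 : ContinuousAt (fun p : G × X => β.base.act p.1⁻¹ p.2) (t, x) :=
    ContinuousAt.comp (x := (t, x)) (f := fun p : G × X => (p.1⁻¹, p.2))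
      (g := fun p : G × X => β.base.act p.1 p.2) (β.base_cont.continuousAt hx') hinv.continuousAt
  have h2 : ContinuousAt (fun p : G × X => (p.1, (⟨β.base.act p.1⁻¹ p.2,
      f (β.base.act p.1⁻¹ p.2)⟩ : Tot B))) (t, x) :=
    continuousAt_fst.prodMk (hf.continuousAt.comp h1)
  have h3 := (β.total_cont.continuousAt (t := t)
    (x := (⟨β.base.act t⁻¹ x, f (β.base.act t⁻¹ x)⟩ : Tot B))
    (β.mem_total_dom.2 (β.base.act_inv_mem hx))).comp (f := fun p : G × X => (p.1,
      (⟨β.base.act p.1⁻¹ p.2, f (β.base.act p.1⁻¹ p.2)⟩ : Tot B))) h2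
  refine h3.congr ?_
  filter_upwards [(β.base_cont.1.preimage hinv).mem_nhds (show (t, x) ∈ _ from hx')] with p hp
  exact (β.push_of_mem p.1 f (by simpa [PartialAction.graphDom] using hp)).symm

/-- Outside `X_t` the value is zero. The set where the pushed section has norm at least `δ` is
compact, hence closed, so near such a point the section stays in a tube around zero. -/
lemma contSection_push [IsTopologicalGroup G] [T2Space X] (hB : IsUSCCStarBundle B) {t : G}
    {f : ∀ x, B x} (hf : ContSection f) (hv : VanishesAtInfinity f)
    (hs : ∀ x ∉ β.base.dom t⁻¹, f x = 0) : ContSection (β.push t f) := by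
  refine continuous_iff_continuousAt.2 fun x => ?_
  by_cases hx : x ∈ β.base.dom t
  · exact (β.continuousAt_push hf hx).comp (f := fun x : X => (t, x)) (by fun_prop)
  · intro W hW
    replace hW : W ∈ 𝓝 (⟨x, 0⟩ : Tot B) := β.push_of_notMem t f hx ▸ hW
    obtain ⟨V, hV, δ, hδ, h⟩ := hB.exists_tube_zero hW
    have hc := (β.vanishesAtInfinity_push hs hv δ hδ).isClosed
    have hmem : x ∈ {x | δ ≤ ‖β.push t f x‖}ᶜ := by
      simp [β.push_of_notMem t f hx, hδ]
    refine Filter.mem_map.2 ?_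
    filter_upwards [hV, hc.isOpen_compl.mem_nhds hmem] with y h1 h2
    exact h _ h1 (not_le.1 h2)

end BundlePartialAction

/-! ### The partial action on `C_0(B)` -/

namespace BundlePartialAction

variable {G : Type*} [Group G] [TopologicalSpace G] {X : Type*} [TopologicalSpace X]
  {B : X → Type*} [∀ x, NonUnitalCStarAlgebra (B x)] [TopologicalSpace (Tot B)]

section Cutoff

variable [T2Space X] [LocallyCompactSpace X]

/-- Sections in `C_0(B)` supported in an open set `U` are approximated by sections with compact
support inside `U`. -/
lemma exists_cutoff (hB : IsUSCCStarBundle B) (f : cZero hB) {U : Set X} (hU : IsOpen U)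
    (hf : ∀ x ∉ U, (f : lp B ∞) x = 0) {ε : ℝ} (hε : 0 < ε) :
    ∃ f₁ : cZero hB, (∀ x, ‖(f : lp B ∞) x - (f₁ : lp B ∞) x‖ ≤ ε) ∧
      ∃ S, IsCompact S ∧ S ⊆ U ∧ ∀ x ∉ S, (f₁ : lp B ∞) x = 0 := by
  -- A Urysohn function equal to `1` where `‖f x‖ ≥ ε`. The approximation is `k • f`; the error `(1
  -- - k) • f` is zero there and has norm below `ε` elsewhere.
  obtain ⟨k, hk1, hkc, hkU, hk⟩ := exists_continuousMap_one_of_isCompact_subset_isOpen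
    (f.2.2 ε hε) hU fun x hx => by
      by_contra hcon
      have : ε ≤ ‖(f : lp B ∞) x‖ := hx
      rw [hf x hcon, norm_zero] at this
      exact absurd this (not_le.2 hε)
  have hle : ∀ x, ‖((k x : ℝ) : ℂ) • (f : lp B ∞) x‖ ≤ ‖(f : lp B ∞) x‖ := fun x => by
    rw [norm_smul, Complex.norm_real, Real.norm_of_nonneg (hk x).1]
    exact mul_le_of_le_one_left (norm_nonneg _) (hk x).2
  have hbd := lp.norm_apply_le_norm ENNReal.top_ne_zero (f : lp B ∞)
  have hcont : ContSection (fun x => ((k x : ℝ) : ℂ) • (f : lp B ∞) x) :=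
    ContSection.smul_fun hB f.2.1 hbd (by fun_prop)
  refine ⟨⟨⟨fun x => ((k x : ℝ) : ℂ) • (f : lp B ∞) x, memℓp_infty ⟨‖(f : lp B ∞)‖, ?_⟩⟩,
    hcont, VanishesAtInfinity.of_le one_pos f.2.2 f.2.2
      (fun δ hδ => hcont.isClosed_le hB hδ) fun x => ?_⟩, fun x => ?_, tsupport k, hkc, hkU,
      fun x hx => ?_⟩
  · rintro _ ⟨x, rfl⟩
    exact (hle x).trans (hbd x)
  · have := hle x
    have := norm_nonneg ((f : lp B ∞) x)
    linarith
  · change ‖(f : lp B ∞) x - ((k x : ℝ) : ℂ) • (f : lp B ∞) x‖ ≤ ε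
    by_cases hx : ε ≤ ‖(f : lp B ∞) x‖
    · rw [hk1 (show x ∈ {x | ε ≤ ‖(f : lp B ∞) x‖} from hx)]
      simpa using hε.le
    · have h1 : (f : lp B ∞) x - ((k x : ℝ) : ℂ) • (f : lp B ∞) x =
          ((1 - k x : ℝ) : ℂ) • (f : lp B ∞) x := by
        rw [Complex.ofReal_sub, sub_smul, Complex.ofReal_one, one_smul]
      rw [h1, norm_smul, Complex.norm_real, Real.norm_of_nonneg (sub_nonneg.2 (hk x).2)]
      refine (mul_le_of_le_one_left (norm_nonneg _) ?_).trans (not_le.1 hx).le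
      linarith [(hk x).1]
  · change ((k x : ℝ) : ℂ) • (f : lp B ∞) x = 0
    rw [image_eq_zero_of_notMem_tsupport hx]
    simp

end Cutoff

lemma cZero_ext {hB : IsUSCCStarBundle B} {f g : cZero hB}
    (h : ⇑(f : lp B ∞) = ⇑(g : lp B ∞)) : f = g := Subtype.ext (lp.ext h)

variable (β : BundlePartialAction G B)

/-- A section supported in a compact subset of `X_{t⁻¹}` moves continuously in norm. -/
lemma eventually_norm_push_sub_le [IsTopologicalGroup G] (hB : IsUSCCStarBundle B)
    {f : ∀ x, B x} (hf : ContSection f) {t : G} {S : Set X} (hS : IsCompact S)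
    (hSt : S ⊆ β.base.dom t⁻¹) (hfS : ∀ x ∉ S, f x = 0) {ε : ℝ} (hε : 0 < ε) :
    ∀ᶠ s in 𝓝 t, S ⊆ β.base.dom s⁻¹ ∧ ∀ x, ‖β.push s f x - β.push t f x‖ ≤ ε := by
  have hS' : IsCompact (β.base.act t '' S) :=
    hS.image_of_continuousOn ((β.base_cont.continuousOn_act t).mono hSt)
  have hpush : ∀ {s : G} {x : X}, x ∉ β.base.act s '' S → β.push s f x = 0 := by
    intro s x hx
    by_contra hne
    obtain ⟨y, -, hy, rfl⟩ := β.mem_of_push_ne_zero hne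
    refine hx ⟨y, ?_, rfl⟩
    by_contra hyS
    exact hy (hfS y hyS)
  -- The difference of the two pushes vanishes at `s = t`, so it is small for `s` near `t`,
  -- uniformly on a neighborhood `v` of `t ⋆ S`.
  obtain ⟨u, v, hu, hv, htu, hSv, huv⟩ := generalized_tube_lemma isCompact_singleton hS'
    (n := interior {p : G × X | ‖β.push p.1 f p.2 - β.push t f p.2‖ < ε}) isOpen_interior (by
      rintro ⟨s, x⟩ ⟨rfl : s = t, y, hy, rfl⟩
      have hx : β.base.act s y ∈ β.base.dom s := β.base.act_mem (hSt hy)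
      have h1 := β.continuousAt_push hf hx
      have h2 : ContinuousAt (fun p : G × X => (⟨p.2, β.push s f p.2⟩ : Tot B))
          (s, β.base.act s y) :=
        ContinuousAt.comp (f := fun p : G × X => (s, p.2))
          (g := fun p : G × X => (⟨p.2, β.push p.1 f p.2⟩ : Tot B)) h1 (by fun_prop)
      rw [mem_interior_iff_mem_nhds]
      exact (hB.continuousAt_sub h1 h2).eventually (hB.eventually_norm_lt (by simpa using hε)))
  -- A second tube: for `s` near `t`, the set `S` lies in the domain of `s` and `s ⋆ S` stays in
  -- `v`. Outside `v` both pushes therefore vanish.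
  obtain ⟨u', v', hu', -, htu', hSv', huv'⟩ := generalized_tube_lemma
    (isCompact_singleton (x := t)) hS (β.base_cont.2.isOpen_inter_preimage β.base_cont.1 hv) (by
      rintro ⟨s, x⟩ ⟨rfl : s = t, hx⟩
      exact ⟨hSt hx, hSv ⟨x, hx, rfl⟩⟩)
  filter_upwards [hu.mem_nhds (htu rfl), hu'.mem_nhds (htu' rfl)] with s hs hs'
  refine ⟨fun x hx => (huv' (mk_mem_prod hs' (hSv' hx))).1, fun x => ?_⟩
  by_cases hx : x ∈ v
  · have := interior_subset (huv (mk_mem_prod hs hx))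
    exact le_of_lt this
  · rw [hpush fun h => hx (hSv h), hpush (s := s), sub_self, norm_zero]
    · exact hε.le
    · rintro ⟨y, hy, rfl⟩
      exact hx (huv' (mk_mem_prod hs' (hSv' hy))).2

/-- The ideal of sections vanishing outside `X_t`. -/
def cZeroDom (hB : IsUSCCStarBundle B) (t : G) : Submodule ℂ (cZero hB) where
  carrier := {f | ∀ x, x ∉ β.base.dom t → ‖(f : lp B ∞) x‖ = 0}
  zero_mem' x _ := norm_zero
  add_mem' {f g} hf hg x hx := by
    have h1 := norm_eq_zero.1 (hf x hx)
    have h2 := norm_eq_zero.1 (hg x hx)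
    change ‖(f : lp B ∞) x + (g : lp B ∞) x‖ = 0
    rw [h1, h2, add_zero, norm_zero]
  smul_mem' k f hf x hx := by
    change ‖k • (f : lp B ∞) x‖ = 0
    rw [norm_smul, hf x hx, mul_zero]

lemma mem_cZeroDom {hB : IsUSCCStarBundle B} {t : G} {f : cZero hB} :
    f ∈ β.cZeroDom hB t ↔ ∀ x ∉ β.base.dom t, (f : lp B ∞) x = 0 :=
  forall₂_congr fun _ _ => norm_eq_zero

lemma mul_mem_cZeroDom {hB : IsUSCCStarBundle B} {t : G} (a : cZero hB) {b : cZero hB}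
    (hb : b ∈ β.cZeroDom hB t) : a * b ∈ β.cZeroDom hB t ∧ b * a ∈ β.cZeroDom hB t := by
  rw [mem_cZeroDom] at hb
  simp only [mem_cZeroDom]
  refine ⟨fun x hx => ?_, fun x hx => ?_⟩
  · change (a : lp B ∞) x * (b : lp B ∞) x = 0
    rw [hb x hx, mul_zero]
  · change (b : lp B ∞) x * (a : lp B ∞) x = 0
    rw [hb x hx, zero_mul]

lemma star_mem_cZeroDom {hB : IsUSCCStarBundle B} {t : G} {a : cZero hB}
    (ha : a ∈ β.cZeroDom hB t) : star a ∈ β.cZeroDom hB t := by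
  rw [mem_cZeroDom] at ha ⊢
  intro x hx
  change star ((a : lp B ∞) x) = 0
  rw [ha x hx, star_zero]

lemma continuous_cZero_apply (hB : IsUSCCStarBundle B) (x : X) :
    Continuous fun f : cZero hB => (f : lp B ∞) x :=
  (lp.evalCLM ℂ B ∞ x).continuous.comp continuous_subtype_val

lemma isClosed_cZeroDom (hB : IsUSCCStarBundle B) (t : G) :
    IsClosed (β.cZeroDom hB t : Set (cZero hB)) := by
  have : (β.cZeroDom hB t : Set (cZero hB)) =
      ⋂ x, ⋂ _ : x ∉ β.base.dom t, {f : cZero hB | ‖(f : lp B ∞) x‖ = 0} := by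
    ext f
    simp only [mem_iInter]
    rfl
  rw [this]
  exact isClosed_iInter fun x => isClosed_iInter fun _ =>
    isClosed_eq (continuous_cZero_apply hB x).norm continuous_const

variable [IsTopologicalGroup G] [T2Space X]

/-- `push`, as a map between ideals of `C_0(B)`. -/
noncomputable def cZeroPush {hB : IsUSCCStarBundle B} (t : G) (f : cZero hB)
    (hf : f ∈ β.cZeroDom hB t⁻¹) : cZero hB :=
  ⟨⟨β.push t ⇑(f : lp B ∞), memℓp_infty ⟨‖(f : lp B ∞)‖, by
      rintro _ ⟨x, rfl⟩
      exact β.norm_push_le t (norm_nonneg _)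
        (lp.norm_apply_le_norm ENNReal.top_ne_zero (f : lp B ∞)) x⟩⟩,
    β.contSection_push hB f.2.1 f.2.2 (β.mem_cZeroDom.1 hf),
    β.vanishesAtInfinity_push (β.mem_cZeroDom.1 hf) f.2.2⟩

open Classical in
/-- The maps of the partial action on `C_0(B)`. -/
noncomputable def cZeroAct (hB : IsUSCCStarBundle B) (t : G) (f : cZero hB) : cZero hB :=
  if hf : f ∈ β.cZeroDom hB t⁻¹ then β.cZeroPush t f hf else f

lemma coe_cZeroAct {hB : IsUSCCStarBundle B} {t : G} {f : cZero hB}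
    (hf : f ∈ β.cZeroDom hB t⁻¹) :
    ⇑(β.cZeroAct hB t f : lp B ∞) = β.push t ⇑(f : lp B ∞) := by
  rw [cZeroAct, dif_pos hf]
  rfl

lemma cZeroAct_mem {hB : IsUSCCStarBundle B} {t : G} {f : cZero hB}
    (hf : f ∈ β.cZeroDom hB t⁻¹) : β.cZeroAct hB t f ∈ β.cZeroDom hB t := by
  rw [mem_cZeroDom, β.coe_cZeroAct hf]
  exact fun x hx => β.push_of_notMem t _ hx

lemma cZeroAct_inv_act {hB : IsUSCCStarBundle B} {t : G} {f : cZero hB}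
    (hf : f ∈ β.cZeroDom hB t⁻¹) : β.cZeroAct hB t⁻¹ (β.cZeroAct hB t f) = f := by
  refine cZero_ext ?_
  rw [β.coe_cZeroAct (by simpa using β.cZeroAct_mem hf), β.coe_cZeroAct hf,
    β.push_inv_push (β.mem_cZeroDom.1 hf)]

/-- The partial action on `C_0(B)`, on the level of sets. -/
noncomputable def cZeroPartialAction (hB : IsUSCCStarBundle B) : PartialAction G (cZero hB) where
  dom t := β.cZeroDom hB t
  act := β.cZeroAct hB
  dom_one := by
    refine eq_univ_of_forall fun f => β.mem_cZeroDom.2 fun x hx => ?_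
    simp [β.base.dom_one] at hx
  act_one f := by
    have hf : f ∈ β.cZeroDom hB 1⁻¹ := β.mem_cZeroDom.2 fun x hx => by
      simp [β.base.dom_one] at hx
    refine cZero_ext ?_
    rw [β.coe_cZeroAct hf, β.push_one]
  bijOn t := by
    refine ⟨fun f hf => β.cZeroAct_mem hf, fun f hf g hg he => ?_, fun f hf => ?_⟩
    · rw [← β.cZeroAct_inv_act hf, ← β.cZeroAct_inv_act hg, he]
    · have hf' : f ∈ β.cZeroDom hB (t⁻¹)⁻¹ := by simpa using hf
      have := β.cZeroAct_inv_act hf'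
      rw [inv_inv] at this
      exact ⟨_, β.cZeroAct_mem hf', this⟩
  comp s t f hf hf' := by
    have h1 := β.mem_cZeroDom.1 hf
    have h2 := β.mem_cZeroDom.1 hf'
    rw [β.coe_cZeroAct hf] at h2
    have h3 : f ∈ β.cZeroDom hB (s * t)⁻¹ := by
      refine β.mem_cZeroDom.2 fun x hx => ?_
      by_contra h0
      have hx' : x ∈ β.base.dom t⁻¹ := by
        by_contra hx'
        exact h0 (h1 x hx')
      refine hx (β.base.comp s t x hx' ?_).1
      by_contra hcon
      have := h2 _ hcon
      rw [← norm_eq_zero, β.norm_push_act t _ hx', norm_eq_zero] at this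
      exact h0 this
    refine ⟨h3, cZero_ext ?_⟩
    rw [β.coe_cZeroAct h3, β.coe_cZeroAct hf', β.coe_cZeroAct hf, β.push_push h1 h2]

variable [LocallyCompactSpace X]

/-- A section in `U` and the ideal of `t` is cut off to one supported in a compact subset of `X_t`.
That compact set lies in `X_s` for `s` near `t`, so the same section witnesses the claim for `s`. -/
lemma isOpen_setOf_cZeroDom_inter (hB : IsUSCCStarBundle B) {U : Set (cZero hB)} (hU : IsOpen U) :
    IsOpen {t | ((β.cZeroDom hB t : Set (cZero hB)) ∩ U).Nonempty} := by
  rw [isOpen_iff_mem_nhds]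
  rintro t ⟨f, hf, hfU⟩
  obtain ⟨ε, hε, hεU⟩ := Metric.isOpen_iff.1 hU f hfU
  obtain ⟨f₁, hf₁, S, hS, hSt, hfS⟩ := exists_cutoff hB f (β.base_cont.isOpen_dom t)
    (β.mem_cZeroDom.1 hf) (half_pos hε)
  have hfU₁ : f₁ ∈ U := by
    refine hεU ?_
    rw [Metric.mem_ball, dist_comm, dist_eq_norm]
    refine (lp.norm_le_of_forall_le (f := ((f - f₁ : cZero hB) : lp B ∞)) (half_pos hε).le
      hf₁).trans_lt (half_lt_self hε)
  -- Only the inclusion of `S` in nearby domains is used, so the bound `1` is arbitrary.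
  have h := β.eventually_norm_push_sub_le hB f₁.2.1 (t := t⁻¹) hS (by simpa using hSt) hfS one_pos
  filter_upwards [continuous_inv.continuousAt.eventually h] with s hs
  refine ⟨f₁, β.mem_cZeroDom.2 fun x hx => hfS x fun hxS => hx ?_, hfU₁⟩
  simpa using hs.1 hxS

lemma continuousOn_cZeroAct (hB : IsUSCCStarBundle B) :
    ContinuousOn (fun p : G × cZero hB => β.cZeroAct hB p.1 p.2)
      {p | p.2 ∈ β.cZeroDom hB p.1⁻¹} := by
  rintro ⟨t, f⟩ hf
  replace hf : f ∈ β.cZeroDom hB t⁻¹ := hf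
  refine Metric.tendsto_nhds.2 fun ε hε => ?_
  -- The comparison goes through `f₁`. As `push` is contractive, the errors are `ε / 4` from `g` to
  -- `f₁` under `s`, `ε / 8` from `s` to `t` on `f₁`, and `ε / 8` from `f₁` to `f` under `t`: at
  -- most `ε / 2` in total.
  obtain ⟨f₁, hf₁, S, hS, hSt, hfS⟩ := exists_cutoff hB f (β.base_cont.isOpen_dom t⁻¹)
    (β.mem_cZeroDom.1 hf) (show 0 < ε / 8 by positivity)
  have h1 := β.eventually_norm_push_sub_le hB f₁.2.1 hS hSt hfS (show 0 < ε / 8 by positivity)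
  have h2 : ∀ᶠ p : G × cZero hB in 𝓝 (t, f), (∀ x, ‖β.push p.1 ⇑(f₁ : lp B ∞) x -
      β.push t ⇑(f₁ : lp B ∞) x‖ ≤ ε / 8) ∧ dist p.2 f < ε / 8 :=
    ((continuousAt_fst.eventually h1).mono fun p hp => hp.2).and
      (continuousAt_snd.eventually (p := fun g => dist g f < ε / 8)
        (Metric.ball_mem_nhds f (by positivity)))
  filter_upwards [nhdsWithin_le_nhds h2, self_mem_nhdsWithin] with ⟨s, g⟩ ⟨h3, h4⟩ hg
  replace hg : g ∈ β.cZeroDom hB s⁻¹ := hg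
  replace h3 : ∀ x, ‖β.push s ⇑(f₁ : lp B ∞) x - β.push t ⇑(f₁ : lp B ∞) x‖ ≤ ε / 8 := h3
  have h5 : ∀ x, ‖(g : lp B ∞) x - (f : lp B ∞) x‖ ≤ ε / 8 := fun x => by
    rw [dist_eq_norm] at h4
    exact (lp.norm_apply_le_norm ENNReal.top_ne_zero ((g - f : cZero hB) : lp B ∞) x).trans h4.le
  have h6 : ∀ x, ‖β.push s (⇑(g : lp B ∞) - ⇑(f₁ : lp B ∞)) x‖ ≤ ε / 4 :=
    β.norm_push_le s (by positivity) fun x => by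
      have := norm_sub_le_norm_sub_add_norm_sub ((g : lp B ∞) x) ((f : lp B ∞) x)
        ((f₁ : lp B ∞) x)
      have := h5 x
      have := hf₁ x
      change ‖(g : lp B ∞) x - (f₁ : lp B ∞) x‖ ≤ _
      linarith
  have h7 : ∀ x, ‖β.push t (⇑(f : lp B ∞) - ⇑(f₁ : lp B ∞)) x‖ ≤ ε / 8 :=
    β.norm_push_le t (by positivity) hf₁
  rw [dist_eq_norm]
  refine (lp.norm_le_of_forall_le
    (f := ((β.cZeroAct hB s g - β.cZeroAct hB t f : cZero hB) : lp B ∞))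
    (show 0 ≤ ε / 2 by positivity) fun x => ?_).trans_lt (half_lt_self hε)
  change ‖(β.cZeroAct hB s g : lp B ∞) x - (β.cZeroAct hB t f : lp B ∞) x‖ ≤ ε / 2
  rw [β.coe_cZeroAct hg, β.coe_cZeroAct hf]
  have h8 := h6 x
  have h9 := h7 x
  rw [push_sub, Pi.sub_apply] at h8 h9
  have h10 := norm_sub_le_norm_sub_add_norm_sub (β.push s ⇑(g : lp B ∞) x)
    (β.push s ⇑(f₁ : lp B ∞) x) (β.push t ⇑(f : lp B ∞) x)
  have h11 := norm_sub_le_norm_sub_add_norm_sub (β.push s ⇑(f₁ : lp B ∞) x)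
    (β.push t ⇑(f₁ : lp B ∞) x) (β.push t ⇑(f : lp B ∞) x)
  rw [norm_sub_rev (β.push t ⇑(f₁ : lp B ∞) x)] at h11
  linarith [h3 x]

/-- The C*-partial dynamical system on `C_0(B)` given by a partial action on `B`. -/
noncomputable def cZeroCStar (hB : IsUSCCStarBundle B) [IsClosed (cZero hB : Set (lp B ∞))] :
    CStarPartialAction G (cZero hB) where
  toPartialAction := β.cZeroPartialAction hB
  ideal t := ⟨β.cZeroDom hB t, rfl, β.isClosed_cZeroDom hB t, fun a _ hb =>
    β.mul_mem_cZeroDom a hb⟩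
  map_add t a ha b hb := cZero_ext <| by
    change ⇑(β.cZeroAct hB t (a + b) : lp B ∞) =
      ⇑(β.cZeroAct hB t a : lp B ∞) + ⇑(β.cZeroAct hB t b : lp B ∞)
    rw [β.coe_cZeroAct ha, β.coe_cZeroAct hb, β.coe_cZeroAct (add_mem ha hb)]
    exact β.push_add t _ _
  map_mul t a ha b hb := cZero_ext <| by
    change ⇑(β.cZeroAct hB t (a * b) : lp B ∞) =
      ⇑(β.cZeroAct hB t a : lp B ∞) * ⇑(β.cZeroAct hB t b : lp B ∞)
    rw [β.coe_cZeroAct ha, β.coe_cZeroAct hb, β.coe_cZeroAct (β.mul_mem_cZeroDom a hb).1]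
    exact β.push_mul t _ _
  map_smul t k a ha := cZero_ext <| by
    change ⇑(β.cZeroAct hB t (k • a) : lp B ∞) = k • ⇑(β.cZeroAct hB t a : lp B ∞)
    rw [β.coe_cZeroAct ha, β.coe_cZeroAct (Submodule.smul_mem _ k ha)]
    exact β.push_smul t k _
  map_star t a ha := cZero_ext <| by
    change ⇑(β.cZeroAct hB t (star a) : lp B ∞) = star ⇑(β.cZeroAct hB t a : lp B ∞)
    rw [β.coe_cZeroAct ha, β.coe_cZeroAct (β.star_mem_cZeroDom ha)]
    exact β.push_star t _
  family_cont _ hU := β.isOpen_setOf_cZeroDom_inter hB hU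
  act_cont := β.continuousOn_cZeroAct hB

lemma isGivenBy_cZeroCStar (hB : IsUSCCStarBundle B) [IsClosed (cZero hB : Set (lp B ∞))] :
    (β.cZeroCStar hB).IsGivenBy β := by
  refine ⟨fun t => rfl, fun t f hf x => ?_⟩
  have h : ⇑((β.cZeroCStar hB).act t f : lp B ∞) = β.push t ⇑(f : lp B ∞) := β.coe_cZeroAct hf
  rw [h]
  exact ⟨β.push_of_mem t _, β.push_of_notMem t _⟩

end BundlePartialAction

/-! ### The orbit bundle -/

/-- The transport of a partial action along a bijection. -/
def PartialAction.congr {G X Y : Type*} [Group G] (a : PartialAction G X) (e : Y ≃ X) :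
    PartialAction G Y where
  dom t := e ⁻¹' a.dom t
  act t y := e.symm (a.act t (e y))
  dom_one := by rw [a.dom_one, preimage_univ]
  act_one y := by rw [a.act_one, e.symm_apply_apply]
  bijOn t := by
    refine ⟨fun y hy => ?_, fun y hy z hz h => ?_, fun y hy => ?_⟩
    · simpa using a.act_mem hy
    · exact e.injective ((a.bijOn t).injOn hy hz (e.symm.injective h))
    · obtain ⟨x, hx, he⟩ := (a.bijOn t).surjOn hy
      exact ⟨e.symm x, by simpa using hx, by simp [he]⟩
  comp s t y hy hy' := by
    simp only [mem_preimage, e.apply_symm_apply] at hy hy' ⊢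
    obtain ⟨h1, h2⟩ := a.comp s t _ hy hy'
    exact ⟨h1, by rw [h2]⟩

lemma PartialAction.IsCont.congr {G X Y : Type*} [Group G] [TopologicalSpace G]
    [TopologicalSpace X] [TopologicalSpace Y] {a : PartialAction G X} (ha : a.IsCont)
    (e : Y ≃ₜ X) : (a.congr e.toEquiv).IsCont := by
  have hc : Continuous fun p : G × Y => (p.1, e p.2) := by fun_prop
  exact ⟨ha.1.preimage hc, e.symm.continuous.comp_continuousOn
    (ha.2.comp hc.continuousOn fun _ hp => hp)⟩

namespace BundlePartialAction

variable {H K : Type*} [Group H] [TopologicalSpace H] [Group K] [TopologicalSpace K]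
  {X : Type*} [TopologicalSpace X] {B : X → Type*} [∀ x, NonUnitalCStarAlgebra (B x)]
  [TopologicalSpace (Tot B)] {α : BundlePartialAction H B}

lemma orbit_proj_eq {b c : Tot B} (h : α.total.orbit b = α.total.orbit c) :
    α.base.orbit b.proj = α.base.orbit c.proj := by
  obtain ⟨t, ht, rfl⟩ := α.total.orbit_eq_iff.1 h
  rw [mem_total_dom] at ht
  exact α.base.orbit_eq_iff.2 ⟨t, ht, (α.proj_act ht).symm⟩

/-- Orbits in the total space meet each fiber in at most one point. -/
lemma eq_of_orbit_eq (hα : α.IsFree) {b c : Tot B} (hp : b.proj = c.proj)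
    (h : α.total.orbit b = α.total.orbit c) : b = c := by
  obtain ⟨t, ht, rfl⟩ := α.total.orbit_eq_iff.1 h
  rw [mem_total_dom] at ht
  rw [α.proj_act ht] at hp
  rw [hα _ t ht hp.symm, α.total.act_one]

lemma exists_orbit_eq {x y : X} (h : α.base.orbit x = α.base.orbit y) (b : B x) :
    ∃ c : B y, α.total.orbit ⟨x, b⟩ = α.total.orbit ⟨y, c⟩ := by
  obtain ⟨t, ht, rfl⟩ := α.base.orbit_eq_iff.1 h
  obtain ⟨φ, hφ⟩ := α.fiber_hom t x ht
  exact ⟨φ b, α.total.orbit_eq_iff.2 ⟨t, α.mem_total_dom.2 ht, hφ b⟩⟩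

lemma orbit_proj_toOrbit {c : Tot α.OrbitFiber} {b : Tot B} (h : α.toOrbit c = α.total.orbit b) :
    c.proj = α.base.orbit b.proj := (Quotient.out_eq _).symm.trans (orbit_proj_eq h)

/-- Freeness gives injectivity on each fiber; surjectivity moves a point along its orbit to the
fiber over the chosen representative. -/
lemma toOrbit_bijective (hα : α.IsFree) : Function.Bijective α.toOrbit := by
  constructor
  · rintro ⟨z, b⟩ ⟨w, c⟩ h
    have hzw := orbit_proj_toOrbit h
    replace hzw : z = w := hzw.trans (Quotient.out_eq w)
    subst hzw
    have h1 := eq_of_orbit_eq hα (b := ⟨z.out, b⟩) (c := ⟨z.out, c⟩) rfl h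
    have h2 : b = c := tot_snd_eq (B := B) (x := z.out) h1
    rw [h2]
  · intro q
    obtain ⟨⟨x, b⟩, rfl⟩ := Quotient.mk_surjective q
    obtain ⟨c, hc⟩ := exists_orbit_eq (α := α) (Quotient.out_eq (α.base.orbit x)).symm b
    exact ⟨⟨α.base.orbit x, c⟩, hc.symm⟩

/-- The total space of the orbit bundle is the orbit space of the total space. -/
noncomputable def toOrbitHomeomorph (hα : α.IsFree) : Tot α.OrbitFiber ≃ₜ α.total.OrbitSpace :=
  (Equiv.ofBijective α.toOrbit (toOrbit_bijective hα)).toHomeomorphOfIsInducing ⟨rfl⟩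

/-- The orbit map `b ↦ Hb`, with values in the orbit bundle. -/
noncomputable def orbitMk (hα : α.IsFree) (b : Tot B) : Tot α.OrbitFiber :=
  (toOrbitHomeomorph hα).symm (α.total.orbit b)

lemma toOrbit_orbitMk (hα : α.IsFree) (b : Tot B) :
    α.toOrbit (orbitMk hα b) = α.total.orbit b :=
  (toOrbitHomeomorph hα).apply_symm_apply _

lemma orbitMk_eq_iff (hα : α.IsFree) {b : Tot B} {c : Tot α.OrbitFiber} :
    orbitMk hα b = c ↔ α.total.orbit b = α.toOrbit c := by
  rw [← (toOrbit_bijective hα).1.eq_iff, toOrbit_orbitMk]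

lemma orbitMk_eq_orbitMk (hα : α.IsFree) {b c : Tot B} :
    orbitMk hα b = orbitMk hα c ↔ α.total.orbit b = α.total.orbit c := by
  rw [orbitMk_eq_iff, toOrbit_orbitMk]

lemma proj_orbitMk (hα : α.IsFree) (b : Tot B) :
    (orbitMk hα b).proj = α.base.orbit b.proj := orbit_proj_toOrbit (toOrbit_orbitMk hα b)

lemma isOpenQuotientMap_orbitMk (hα : α.IsFree) : IsOpenQuotientMap (orbitMk hα) :=
  (toOrbitHomeomorph hα).symm.isOpenQuotientMap.comp α.total_cont.isOpenQuotientMap_orbit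

/-- On fibers the orbit map is an isomorphism of C*-algebras. -/
lemma exists_orbitMk_equiv (hα : α.IsFree) {x : X} {z : α.base.OrbitSpace}
    (hz : α.base.orbit x = z) :
    ∃ ψ : B x ≃⋆ₐ[ℂ] α.OrbitFiber z, ∀ b, orbitMk hα ⟨x, b⟩ = ⟨z, ψ b⟩ := by
  obtain ⟨t, ht, he⟩ := α.base.orbit_eq_iff.1 (hz.trans (Quotient.out_eq z).symm)
  obtain ⟨φ, hφ⟩ : ∃ φ : B x →⋆ₙₐ[ℂ] B z.out, ∀ b, α.total.act t ⟨x, b⟩ = ⟨z.out, φ b⟩ := by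
    rw [← he]
    exact α.fiber_hom t x ht
  have ho : ∀ b, α.total.orbit ⟨x, b⟩ = α.total.orbit ⟨z.out, φ b⟩ := fun b =>
    α.total.orbit_eq_iff.2 ⟨t, α.mem_total_dom.2 ht, hφ b⟩
  have hbij : Function.Bijective φ := by
    refine ⟨fun b c h => ?_, fun c => ?_⟩
    · exact tot_snd_eq (eq_of_orbit_eq hα rfl (by rw [ho, ho, h]))
    · obtain ⟨b, hb⟩ := exists_orbit_eq (α := α) (hz.trans (Quotient.out_eq z).symm).symm c
      refine ⟨b, tot_snd_eq (eq_of_orbit_eq hα rfl ?_)⟩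
      rw [← ho, hb]
  exact ⟨StarAlgEquiv.ofBijective φ hbij, fun b => (orbitMk_eq_iff hα).2 (ho b)⟩

lemma norm_orbitMk (hα : α.IsFree) (b : Tot B) : ‖(orbitMk hα b).snd‖ = ‖b.snd‖ := by
  obtain ⟨ψ, hψ⟩ := exists_orbitMk_equiv hα (x := b.proj) rfl
  have h : orbitMk hα b = ⟨_, ψ b.snd⟩ := hψ b.snd
  rw [h]
  exact NonUnitalStarAlgHom.norm_map ψ ψ.injective _

lemma exists_orbitMk_eq (hα : α.IsFree) {x : X} (c : α.OrbitFiber (α.base.orbit x)) :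
    ∃ b : B x, orbitMk hα ⟨x, b⟩ = ⟨α.base.orbit x, c⟩ := by
  obtain ⟨ψ, hψ⟩ := exists_orbitMk_equiv hα (x := x) rfl
  exact ⟨ψ.symm c, by rw [hψ, ψ.apply_symm_apply]⟩

/-! ### Continuity of the bundle structure on the orbit space. -/

section Proper

variable [LocallyCompactSpace X] [T2Space X]

/-- The topology of the total space is induced by the projection and the orbit map. -/
lemma exists_nhds_proj_orbitMk (hα : α.IsFree) (hp : α.IsProper) {b : Tot B} {W : Set (Tot B)}
    (hW : W ∈ 𝓝 b) : ∃ V ∈ 𝓝 b.proj, ∃ U ∈ 𝓝 (orbitMk hα b), ∀ c : Tot B,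
      c.proj ∈ V → orbitMk hα c ∈ U → c ∈ W := by
  have h1 : ContinuousAt (fun p : H × Tot B => α.total.act p.1 p.2) (1, b) :=
    α.total_cont.continuousAt (by simp [α.total.dom_one])
  have h2 := h1 (show W ∈ 𝓝 (α.total.act 1 b) by rwa [α.total.act_one])
  -- Group elements in `N` keep `W'` inside `W`. If `Hc` has a representative `w` in `W'` over `V'`
  -- and `c` lies over `V`, then `c` is a translate of `w` by an element of `N`, hence in `W`.
  obtain ⟨N, hN, W', hW', h3⟩ := mem_nhds_prod_iff.1 h2
  obtain ⟨V', hV', V, hV, h4⟩ := mem_nhds_prod_iff.1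
    (α.base_cont.eventually_mem_of_act_eq hα hp b.proj hN)
  refine ⟨V, hV, orbitMk hα '' (W' ∩ (fun b : Tot B => b.proj) ⁻¹' V'),
    (isOpenQuotientMap_orbitMk hα).isOpenMap.image_mem_nhds
      (inter_mem hW' (α.proj_morphism.1.continuousAt.preimage_mem_nhds hV')), ?_⟩
  rintro c hc ⟨w, ⟨hw, hwV⟩, he⟩
  obtain ⟨t, ht, rfl⟩ := α.total.orbit_eq_iff.1 ((orbitMk_eq_orbitMk hα).1 he)
  have ht' := α.mem_total_dom.1 ht
  have hmem : (w.proj, (α.total.act t w).proj) ∈ V' ×ˢ V := ⟨hwV, hc⟩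
  have htN : t ∈ N := h4 hmem t ht' (α.proj_act ht').symm
  exact h3 (mk_mem_prod htN hw)

/-- A fiberwise binary operation of the orbit bundle is continuous if it comes from a continuous
operation of the bundle. -/
lemma continuous_fiberPair_orbitFiber (hα : α.IsFree) (hp : α.IsProper)
    {F : (Σ x, B x × B x) → Tot B}
    {F' : (Σ z, α.OrbitFiber z × α.OrbitFiber z) → Tot α.OrbitFiber}
    (hF : Continuous[fiberPairTopology B, inferInstance] F)
    (h : ∀ x, ∀ b c : B x, ∀ b' c' : α.OrbitFiber (α.base.orbit x),
      orbitMk hα ⟨x, b⟩ = ⟨_, b'⟩ → orbitMk hα ⟨x, c⟩ = ⟨_, c'⟩ →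
      orbitMk hα (F ⟨x, b, c⟩) = F' ⟨_, b', c'⟩) :
    Continuous[fiberPairTopology α.OrbitFiber, inferInstance] F' := by
  refine continuous_fiberPair_iff.2 fun z b' c' W hW => ?_
  obtain ⟨x, rfl⟩ := Quotient.mk_surjective z
  obtain ⟨b, hb⟩ := exists_orbitMk_eq hα b'
  obtain ⟨c, hc⟩ := exists_orbitMk_eq hα c'
  have hW' : W ∈ 𝓝 (orbitMk hα (F ⟨x, b, c⟩)) := (h x b c b' c' hb hc) ▸ hW
  obtain ⟨U₁, hU₁, U₂, hU₂, hU⟩ := continuous_fiberPair_iff.1 hF x b c _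
    ((isOpenQuotientMap_orbitMk hα).continuous.continuousAt hW')
  obtain ⟨V₁, hV₁, N₁, hN₁, h₁⟩ := exists_nhds_proj_orbitMk hα hp hU₁
  obtain ⟨V₂, hV₂, N₂, hN₂, h₂⟩ := exists_nhds_proj_orbitMk hα hp hU₂
  have hproj : Continuous fun q : Tot α.OrbitFiber => q.proj := by
    rw [← (isOpenQuotientMap_orbitMk hα).continuous_comp_iff]
    exact (continuous_quotient_mk'.comp α.proj_morphism.1).congr
      fun b => (proj_orbitMk hα b).symm
  have hV : α.base.orbit '' (V₁ ∩ V₂) ∈ 𝓝 (α.base.orbit x) :=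
    α.base_cont.isOpenMap_orbit.image_mem_nhds (inter_mem hV₁ hV₂)
  rw [hb] at hN₁
  rw [hc] at hN₂
  -- Both points must be lifted over one `y` in `V₁ ∩ V₂`. They share a fiber, so it suffices to
  -- constrain the projection of the first.
  refine ⟨_, inter_mem hN₁ (hproj.continuousAt.preimage_mem_nhds hV), N₂, hN₂, ?_⟩
  rintro w b₁ c₁ ⟨h3, h4⟩ h5
  obtain ⟨y, hy, rfl⟩ : w ∈ α.base.orbit '' (V₁ ∩ V₂) := h4
  obtain ⟨b₂, hb₂⟩ := exists_orbitMk_eq hα b₁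
  obtain ⟨c₂, hc₂⟩ := exists_orbitMk_eq hα c₁
  rw [← h y b₂ c₂ b₁ c₁ hb₂ hc₂]
  exact hU y b₂ c₂ (h₁ _ hy.1 (by rwa [hb₂])) (h₂ _ hy.2 (by rwa [hc₂]))

/-- The orbit bundle of a free and proper partial action is an upper semicontinuous C*-bundle. -/
lemma isUSCCStarBundle_orbitFiber (hB : IsUSCCStarBundle B) (hα : α.IsFree) (hp : α.IsProper) :
    IsUSCCStarBundle α.OrbitFiber := by
  have hq := isOpenQuotientMap_orbitMk hα
  have hcomp : (fun q : Tot α.OrbitFiber => q.proj) ∘ orbitMk hα =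
      α.base.orbit ∘ fun b : Tot B => b.proj := funext fun b => proj_orbitMk hα b
  have hψ : ∀ b : Tot B, ∃ ψ : B b.proj ≃⋆ₐ[ℂ] α.OrbitFiber (α.base.orbit b.proj),
      ∀ c, orbitMk hα ⟨b.proj, c⟩ = ⟨_, ψ c⟩ := fun b => exists_orbitMk_equiv hα rfl
  constructor
  · rw [← hq.continuous_comp_iff, hcomp]
    exact continuous_quotient_mk'.comp hB.continuous_proj
  · rw [hq.isOpenMap_iff, hcomp]
    exact α.base_cont.isOpenMap_orbit.comp hB.isOpenMap_proj
  · exact fun z => ⟨⟨z, 0⟩, rfl⟩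
  · intro ε hε
    rw [← hq.isQuotientMap.isOpen_preimage]
    convert hB.isOpen_norm_lt ε hε using 1
    ext b
    change ‖(orbitMk hα b).snd‖ < ε ↔ ‖b.snd‖ < ε
    rw [norm_orbitMk]
  · refine continuous_fiberPair_orbitFiber hα hp hB.continuous_add fun x b c b' c' hb hc => ?_
    obtain ⟨ψ, hψ⟩ := exists_orbitMk_equiv hα (x := x) rfl
    rw [hψ] at hb hc
    rw [hψ, map_add, tot_snd_eq hb, tot_snd_eq hc]
  · refine continuous_fiberPair_orbitFiber hα hp hB.continuous_mul fun x b c b' c' hb hc => ?_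
    obtain ⟨ψ, hψ⟩ := exists_orbitMk_equiv hα (x := x) rfl
    rw [hψ] at hb hc
    rw [hψ, map_mul, tot_snd_eq hb, tot_snd_eq hc]
  · intro k
    rw [← hq.continuous_comp_iff]
    refine (hq.continuous.comp (hB.continuous_smul k)).congr fun b => ?_
    obtain ⟨ψ, hψ⟩ := hψ b
    have h : orbitMk hα b = ⟨_, ψ b.snd⟩ := hψ b.snd
    simp only [Function.comp_apply]
    rw [hψ, h, map_smul]
  · rw [← hq.continuous_comp_iff]
    refine (hq.continuous.comp hB.continuous_star).congr fun b => ?_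
    obtain ⟨ψ, hψ⟩ := hψ b
    have h : orbitMk hα b = ⟨_, ψ b.snd⟩ := hψ b.snd
    simp only [Function.comp_apply]
    rw [hψ, h, map_star]
  · intro z l hl hl' W hW
    obtain ⟨x, rfl⟩ := Quotient.mk_surjective z
    obtain ⟨ψ, hψ⟩ := exists_orbitMk_equiv hα (x := x) rfl
    have hW' : W ∈ 𝓝 (orbitMk hα ⟨x, 0⟩) := by
      rw [hψ, map_zero]
      exact hW
    -- The tube around `0_x` descends because the orbit map is open on the base and preserves norms.
    obtain ⟨V, hV, δ, hδ, h⟩ := hB.exists_tube_zero (hq.continuous.continuousAt hW')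
    have h1 := hl (α.base_cont.isOpenMap_orbit.image_mem_nhds hV)
    have h2 := hl'.eventually_lt_const hδ
    filter_upwards [h1, h2]
    rintro ⟨w, c⟩ h3 h4
    obtain ⟨y, hy, rfl⟩ : w ∈ α.base.orbit '' V := h3
    obtain ⟨b', hb'⟩ := exists_orbitMk_eq hα c
    rw [← hb']
    refine h _ hy ?_
    rw [← norm_orbitMk hα, hb']
    exact h4

end Proper

/-! ### The induced partial action on the orbit bundle -/

variable {β : BundlePartialAction K B}

lemma congr_quotient_act (hα : α.IsFree) (ht : α.total.Commutes β.total) {t : K} {b : Tot B}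
    (hb : b.proj ∈ β.base.dom t⁻¹) :
    (ht.quotient.congr (toOrbitHomeomorph hα).toEquiv).act t (orbitMk hα b) =
      orbitMk hα (β.total.act t b) := by
  change (toOrbitHomeomorph hα).symm (ht.quotient.act t (α.toOrbit (orbitMk hα b))) = _
  rw [toOrbit_orbitMk, ht.quotient_act (β.mem_total_dom.2 hb)]
  rfl

lemma mem_congr_quotient_dom (hα : α.IsFree) (ht : α.total.Commutes β.total) {t : K} {b : Tot B} :
    orbitMk hα b ∈ (ht.quotient.congr (toOrbitHomeomorph hα).toEquiv).dom t ↔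
      b.proj ∈ β.base.dom t := by
  change α.toOrbit (orbitMk hα b) ∈ ht.quotient.dom t ↔ _
  rw [toOrbit_orbitMk, ht.orbit_mem_quotient_dom, mem_total_dom]

/-- The partial action induced on the orbit bundle. -/
noncomputable def quotient (hα : α.IsFree) (ht : α.total.Commutes β.total)
    (hc : α.base.Commutes β.base) :
    BundlePartialAction K α.OrbitFiber where
  total := ht.quotient.congr (toOrbitHomeomorph hα).toEquiv
  base := hc.quotient
  total_cont := (ht.isCont_quotient α.total_cont β.total_cont).congr (toOrbitHomeomorph hα)
  base_cont := hc.isCont_quotient α.base_cont β.base_cont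
  preimage_dom t := by
    ext q
    obtain ⟨b, rfl⟩ := (isOpenQuotientMap_orbitMk hα).surjective q
    rw [mem_congr_quotient_dom, mem_preimage,
      proj_orbitMk, hc.orbit_mem_quotient_dom]
  proj_morphism := by
    refine ⟨?_, fun t q hq => ?_, fun t q hq => ?_⟩
    · rw [← (isOpenQuotientMap_orbitMk hα).continuous_comp_iff]
      exact (continuous_quotient_mk'.comp α.proj_morphism.1).congr
        fun b => (proj_orbitMk hα b).symm
    · obtain ⟨b, rfl⟩ := (isOpenQuotientMap_orbitMk hα).surjective q
      rw [mem_congr_quotient_dom] at hq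
      change (orbitMk hα b).proj ∈ _
      rw [proj_orbitMk, hc.orbit_mem_quotient_dom]
      exact hq
    · obtain ⟨b, rfl⟩ := (isOpenQuotientMap_orbitMk hα).surjective q
      rw [mem_congr_quotient_dom] at hq
      change hc.quotient.act t (orbitMk hα b).proj = Bundle.TotalSpace.proj _
      rw [congr_quotient_act hα ht hq, proj_orbitMk, proj_orbitMk, hc.quotient_act hq,
        β.proj_act hq]
  fiber_hom t z hz := by
    obtain ⟨x, rfl⟩ := Quotient.mk_surjective z
    have hx : x ∈ β.base.dom t⁻¹ := hc.orbit_mem_quotient_dom.1 hz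
    obtain ⟨φ, hφ⟩ := β.fiber_hom t x hx
    obtain ⟨ψ, hψ⟩ := exists_orbitMk_equiv hα (x := x) rfl
    -- The target fiber is taken over `hc.quotient.act t (α.base.orbit x)` itself, so `φ` is
    -- conjugated by `ψ` and `ψ'` without a cast.
    obtain ⟨ψ', hψ'⟩ := exists_orbitMk_equiv hα (hc.quotient_act hx).symm
    refine ⟨((ψ' : _ →⋆ₙₐ[ℂ] _).comp φ).comp (ψ.symm : _ →⋆ₙₐ[ℂ] _), fun c => ?_⟩
    have h : (⟨_, c⟩ : Tot α.OrbitFiber) = orbitMk hα ⟨x, ψ.symm c⟩ := by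
      rw [hψ, ψ.apply_symm_apply]
    rw [h, congr_quotient_act hα ht (b := ⟨x, ψ.symm c⟩) hx, hφ, hψ']
    rfl

lemma isQuotientAction_quotient (hα : α.IsFree) (ht : α.total.Commutes β.total)
    (hc : α.base.Commutes β.base) :
    α.IsQuotientAction β (quotient hα ht hc) := by
  refine ⟨fun t => rfl, fun t x hx => hc.quotient_act hx, fun t b hb c h => ?_⟩
  have hcb : c = orbitMk hα b := ((orbitMk_eq_iff hα).2 h.symm).symm
  rw [hcb, ← toOrbit_orbitMk hα]
  exact congrArg α.toOrbit (congr_quotient_act hα ht (β.mem_total_dom.1 hb))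

end BundlePartialAction

/-! ### Transport of C*-partial dynamical systems -/

/-- The transport of a C*-partial dynamical system along a *-isomorphism. -/
def CStarPartialAction.congr {G A A' : Type*} [Group G] [TopologicalSpace G]
    [NonUnitalCStarAlgebra A] [NonUnitalCStarAlgebra A'] (δ : CStarPartialAction G A')
    (Φ : A ≃⋆ₐ[ℂ] A') (hΦ : Continuous Φ) (hΦ' : Continuous Φ.symm) : CStarPartialAction G A where
  toPartialAction := δ.toPartialAction.congr Φ.toEquiv
  ideal t := by
    obtain ⟨I, hI, hc, hm⟩ := δ.ideal t
    have hmem : ∀ a, Φ a ∈ I ↔ Φ a ∈ δ.dom t := fun a => by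
      rw [← hI]
      rfl
    refine ⟨{ carrier := {a | Φ a ∈ I}, add_mem' := ?_, zero_mem' := ?_, smul_mem' := ?_ },
      ?_, hc.preimage hΦ, ?_⟩
    · intro a b ha hb
      change Φ (a + b) ∈ I
      rw [_root_.map_add]
      exact add_mem ha hb
    · change Φ 0 ∈ I
      rw [map_zero]
      exact zero_mem I
    · intro k a ha
      change Φ (k • a) ∈ I
      rw [_root_.map_smul]
      exact I.smul_mem k ha
    · ext a
      exact hmem a
    · intro a b hb
      have := hm (Φ a) (Φ b) hb
      rw [← _root_.map_mul, ← _root_.map_mul] at this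
      exact this
  map_add t a ha b hb := by
    change Φ.symm (δ.act t (Φ (a + b))) = Φ.symm (δ.act t (Φ a)) + Φ.symm (δ.act t (Φ b))
    rw [_root_.map_add, δ.map_add t (Φ a) ha (Φ b) hb, _root_.map_add]
  map_mul t a ha b hb := by
    change Φ.symm (δ.act t (Φ (a * b))) = Φ.symm (δ.act t (Φ a)) * Φ.symm (δ.act t (Φ b))
    rw [_root_.map_mul, δ.map_mul t (Φ a) ha (Φ b) hb, _root_.map_mul]
  map_smul t k a ha := by
    change Φ.symm (δ.act t (Φ (k • a))) = k • Φ.symm (δ.act t (Φ a))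
    rw [_root_.map_smul, δ.map_smul t k (Φ a) ha, _root_.map_smul]
  map_star t a ha := by
    change Φ.symm (δ.act t (Φ (star a))) = star (Φ.symm (δ.act t (Φ a)))
    rw [StarHomClass.map_star, δ.map_star t (Φ a) ha, StarHomClass.map_star]
  family_cont U hU := by
    have h := δ.family_cont (Φ.symm ⁻¹' U) (hU.preimage hΦ')
    convert h using 1
    ext t
    constructor
    · rintro ⟨a, ha, haU⟩
      refine ⟨Φ a, ha, ?_⟩
      rw [mem_preimage, Φ.symm_apply_apply]
      exact haU
    · rintro ⟨a, ha, haU⟩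
      refine ⟨Φ.symm a, ?_, haU⟩
      change Φ (Φ.symm a) ∈ δ.dom t
      rw [Φ.apply_symm_apply]
      exact ha
  act_cont := by
    have hc : Continuous fun p : G × A => (p.1, Φ p.2) := by fun_prop
    exact hΦ'.comp_continuousOn (δ.act_cont.comp hc.continuousOn fun _ hp => hp)

/-! ### The isomorphism of `Ind_0(B, α)` with `C_0(B/H)` -/

namespace BundlePartialAction

variable {H K : Type*} [Group H] [TopologicalSpace H] [Group K] [TopologicalSpace K]
  {X : Type*} [TopologicalSpace X] {B : X → Type*} [∀ x, NonUnitalCStarAlgebra (B x)]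
  [TopologicalSpace (Tot B)] {α : BundlePartialAction H B} {β : BundlePartialAction K B}

/-- The *-homomorphism `Ind`. -/
noncomputable def indHom (hB : IsUSCCStarBundle B) (hQ : IsUSCCStarBundle α.OrbitFiber) :
    α.indZero hB →⋆ₙₐ[ℂ] cZero hQ where
  toFun f := ⟨⟨α.ind ⇑(f : lp B ∞), memℓp_infty ⟨‖(f : lp B ∞)‖, by
    rintro _ ⟨z, rfl⟩
    exact lp.norm_apply_le_norm ENNReal.top_ne_zero (f : lp B ∞) z.out⟩⟩, f.2.2⟩
  map_smul' _ _ := rfl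
  map_zero' := rfl
  map_add' _ _ := rfl
  map_mul' _ _ := rfl
  map_star' _ := rfl

/-- For equivariant `f` the function `‖f x‖` is constant on orbits, so the supremum over
representatives is the full supremum. -/
lemma norm_indHom (hB : IsUSCCStarBundle B) (hQ : IsUSCCStarBundle α.OrbitFiber)
    (f : α.indZero hB) : ‖indHom hB hQ f‖ = ‖f‖ := by
  apply le_antisymm
  · exact lp.norm_le_of_forall_le (f := (indHom hB hQ f : lp α.OrbitFiber ∞)) (norm_nonneg f)
      fun z => lp.norm_apply_le_norm ENNReal.top_ne_zero (f : lp B ∞) z.out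
  · refine lp.norm_le_of_forall_le (f := (f : lp B ∞)) (norm_nonneg _) fun x => ?_
    rw [← α.norm_ind f.2.1.2 x]
    exact lp.norm_apply_le_norm ENNReal.top_ne_zero (indHom hB hQ f : lp α.OrbitFiber ∞)
      (α.base.orbit x)

lemma isometry_indHom (hB : IsUSCCStarBundle B) (hQ : IsUSCCStarBundle α.OrbitFiber) :
    Isometry (indHom (α := α) hB hQ) :=
  AddMonoidHomClass.isometry_of_norm _ (norm_indHom hB hQ)

lemma orbitMk_ind (hα : α.IsFree) {f : ∀ x, B x} (hf : α.IsEquivariant f) (x : X) :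
    orbitMk hα ⟨x, f x⟩ = ⟨α.base.orbit x, α.ind f (α.base.orbit x)⟩ :=
  (orbitMk_eq_iff hα).2 (α.toOrbit_ind hf x).symm

/-- The lift `f x` is the point of `B x` whose orbit is `g (Hx)`. It is continuous because its
projection and its orbit depend continuously on `x`, and equivariant because an orbit meets each
fiber at most once. -/
lemma surjective_indHom [LocallyCompactSpace X] [T2Space X] (hα : α.IsFree) (hp : α.IsProper)
    (hB : IsUSCCStarBundle B) (hQ : IsUSCCStarBundle α.OrbitFiber) :
    Function.Surjective (indHom (α := α) hB hQ) := by
  intro g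
  choose f hf using fun x : X => exists_orbitMk_eq hα ((g : lp α.OrbitFiber ∞) (α.base.orbit x))
  have hcont : ContSection f := by
    refine continuous_iff_continuousAt.2 fun x W hW => ?_
    obtain ⟨V, hV, U, hU, h⟩ := exists_nhds_proj_orbitMk hα hp hW
    rw [hf x] at hU
    have hg : Continuous fun x => (⟨α.base.orbit x, (g : lp α.OrbitFiber ∞) (α.base.orbit x)⟩ :
        Tot α.OrbitFiber) := Continuous.comp (g := fun z => (⟨z, (g : lp α.OrbitFiber ∞) z⟩ :
          Tot α.OrbitFiber)) g.2.1 continuous_quotient_mk'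
    refine Filter.mem_map.2 ?_
    filter_upwards [hV, hg.continuousAt hU] with y h1 h2
    exact h _ h1 (by rw [hf y]; exact h2)
  have hind : α.ind f = ⇑(g : lp α.OrbitFiber ∞) := by
    funext z
    have h1 : orbitMk hα ⟨z.out, f z.out⟩ = ⟨z, α.ind f z⟩ := (orbitMk_eq_iff hα).2 rfl
    have h2 : ∀ w, w = z → (⟨w, (g : lp α.OrbitFiber ∞) w⟩ : Tot α.OrbitFiber) =
        ⟨z, (g : lp α.OrbitFiber ∞) z⟩ := by
      rintro w rfl
      rfl
    exact tot_snd_eq (h1.symm.trans ((hf z.out).trans (h2 _ z.out_eq)))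
  have hequiv : α.IsEquivariant f := by
    refine (α.isEquivariant_iff hcont).2 fun t x hx => ?_
    have hm : (⟨x, f x⟩ : Tot B) ∈ α.total.dom t⁻¹ := α.mem_total_dom.2 hx
    refine eq_of_orbit_eq hα (α.proj_act (b := ⟨x, f x⟩) hx) ?_
    rw [α.total.orbit_act hm, ← orbitMk_eq_orbitMk hα, hf, hf, α.base.orbit_act hx]
  have hbd : ∀ x, ‖f x‖ ≤ ‖(g : lp α.OrbitFiber ∞)‖ := fun x => by
    have h := norm_orbitMk hα ⟨x, f x⟩
    rw [hf x] at h
    exact h.symm.trans_le (lp.norm_apply_le_norm ENNReal.top_ne_zero _ _)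
  refine ⟨⟨⟨f, memℓp_infty ⟨_, by rintro _ ⟨x, rfl⟩; exact hbd x⟩⟩, ⟨hcont, hequiv⟩, ?_⟩,
    cZero_ext hind⟩
  change ContSection (α.ind f) ∧ VanishesAtInfinity (α.ind f)
  rw [hind]
  exact g.2.imp_left fun h => h

/-- The *-isomorphism `Ind`. -/
noncomputable def indEquiv [LocallyCompactSpace X] [T2Space X] (hα : α.IsFree) (hp : α.IsProper)
    (hB : IsUSCCStarBundle B) (hQ : IsUSCCStarBundle α.OrbitFiber) :
    α.indZero hB ≃⋆ₐ[ℂ] cZero hQ :=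
  StarAlgEquiv.ofBijective (indHom hB hQ)
    ⟨(isometry_indHom hB hQ).injective, surjective_indHom hα hp hB hQ⟩

lemma isometry_indEquiv_symm [LocallyCompactSpace X] [T2Space X] (hα : α.IsFree)
    (hp : α.IsProper) (hB : IsUSCCStarBundle B) (hQ : IsUSCCStarBundle α.OrbitFiber) :
    Isometry (indEquiv hα hp hB hQ).symm :=
  (isometry_indHom hB hQ).right_inv (indEquiv hα hp hB hQ).apply_symm_apply

/-- The algebra is the range of the isometry `Ind⁻¹`, defined on the complete space `C_0(B/H)`. -/
lemma isClosed_indZero [LocallyCompactSpace X] [T2Space X] (hα : α.IsFree)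
    (hp : α.IsProper) (hB : IsUSCCStarBundle B) :
    IsClosed (α.indZero hB : Set (lp B ∞)) := by
  have hQ := isUSCCStarBundle_orbitFiber hB hα hp
  have : CompleteSpace (cZero hQ) := (isClosed_cZero hQ).completeSpace_coe
  have h : Isometry fun g => ((indEquiv hα hp hB hQ).symm g : lp B ∞) :=
    isometry_subtype_coe.comp (isometry_indEquiv_symm hα hp hB hQ)
  convert h.isClosedEmbedding.isClosed_range using 1
  ext f
  constructor
  · exact fun hf => ⟨indEquiv hα hp hB hQ ⟨f, hf⟩, by simp⟩
  · rintro ⟨g, rfl⟩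
    exact ((indEquiv hα hp hB hQ).symm g).2

/-- A partial action on `Ind_0(B, α)` which `Ind` carries to the one given by `μ` on `C_0(B/H)` is
the one given by `β`, if `μ` is induced by `β`. -/
lemma isGivenBy_of_ind (hα : α.IsFree) (hc : α.base.Commutes β.base)
    (hB : IsUSCCStarBundle B) {hQ : IsUSCCStarBundle α.OrbitFiber}
    [IsClosed (α.indZero hB : Set (lp B ∞))] [IsClosed (cZero hQ : Set (lp α.OrbitFiber ∞))]
    {μ : BundlePartialAction K α.OrbitFiber} (hμ : α.IsQuotientAction β μ)
    {γ : CStarPartialAction K (α.indZero hB)} {δ : CStarPartialAction K (cZero hQ)}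
    (hδ : δ.IsGivenBy μ) (hdom : ∀ t f, f ∈ γ.dom t ↔ indHom hB hQ f ∈ δ.dom t)
    (hact : ∀ t, ∀ f ∈ γ.dom t⁻¹, indHom hB hQ (γ.act t f) = δ.act t (indHom hB hQ f)) :
    γ.IsGivenBy β := by
  have hmem : ∀ t x, α.base.orbit x ∈ μ.base.dom t ↔ x ∈ β.base.dom t := fun t x => by
    rw [hμ.1 t, hc.orbit_mem_image_iff]
  have hcoe : ∀ f : α.indZero hB, ⇑(indHom hB hQ f : lp α.OrbitFiber ∞) =
      α.ind ⇑(f : lp B ∞) := fun f => rfl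
  refine ⟨fun t => ?_, fun t f hf x => ?_⟩
  · ext f
    rw [hdom, hδ.1 t]
    change (∀ z, z ∉ μ.base.dom t → ‖α.ind ⇑(f : lp B ∞) z‖ = 0) ↔ _
    constructor
    · intro h x hx
      rw [← α.norm_ind f.2.1.2 x]
      exact h _ (mt (hmem t x).1 hx)
    · intro h z hz
      obtain ⟨x, rfl⟩ := Quotient.mk_surjective z
      exact (α.norm_ind f.2.1.2 x).trans (h x (mt (hmem t x).2 hz))
  · have hz := hδ.2 t _ ((hdom _ _).1 hf) (α.base.orbit x)
    rw [← hact t f hf, hcoe, hcoe] at hz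
    refine ⟨fun hx => ?_, fun hx => ?_⟩
    · have h1 := hz.1 ((hmem t x).2 hx)
      have hx' := β.base.act_inv_mem hx
      rw [hμ.2.1 t⁻¹ x (by simpa using hx), ← orbitMk_ind hα f.2.1.2,
        ← orbitMk_ind hα (γ.act t f).2.1.2] at h1
      -- Both sides lie over `x`, so it is enough to compare their orbits, which is the formula for
      -- `μ`.
      refine eq_of_orbit_eq hα ?_ ?_
      · rw [β.proj_act (b := ⟨_, _⟩) hx']
        exact (β.base.act_act_inv hx).symm
      · rw [← toOrbit_orbitMk hα, h1]
        exact hμ.2.2 t _ (β.mem_total_dom.2 hx') _ (toOrbit_orbitMk hα _)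
    · have h1 := hz.2 (mt (hmem t x).1 hx)
      rw [← norm_eq_zero, ← α.norm_ind (γ.act t f).2.1.2 x, h1, norm_zero]

end BundlePartialAction

/-! ### The main theorem. -/

theorem mainTheorem8 {H K X : Type*}
    [Group H] [TopologicalSpace H] [IsTopologicalGroup H] [LocallyCompactSpace H] [T2Space H]
    [Group K] [TopologicalSpace K] [IsTopologicalGroup K] [LocallyCompactSpace K] [T2Space K]
    [TopologicalSpace X] [LocallyCompactSpace X] [T2Space X]
    {B : X → Type*} [∀ x, NonUnitalCStarAlgebra (B x)] [TopologicalSpace (Tot B)]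
    (hB : IsUSCCStarBundle B)
    (α : BundlePartialAction H B) (β : BundlePartialAction K B)
    (hfree : α.IsFree) (hproper : α.IsProper) (hcomm : α.Commutes β) :
    -- `Ind_0(B, α)` is a C*-algebra, and `γ`, given by `β`, is a partial action of `K` on it
    ∃ (_ : IsClosed (α.indZero hB : Set (lp B ∞)))
      (γ : CStarPartialAction K (α.indZero hB)), γ.IsGivenBy β ∧
    -- it corresponds to the partial action `δ` on `C_0(B/H)` given by the induced action `μ` on `B/H`
    ∃ (hQ : IsUSCCStarBundle α.OrbitFiber) (_ : IsClosed (cZero hQ : Set (lp α.OrbitFiber ∞)))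
      (μ : BundlePartialAction K α.OrbitFiber) (δ : CStarPartialAction K (cZero hQ))
      (Φ : α.indZero hB ≃⋆ₐ[ℂ] cZero hQ),
      α.IsQuotientAction β μ ∧ δ.IsGivenBy μ ∧
      (∀ f, ⇑(Φ f : lp α.OrbitFiber ∞) = α.ind ⇑(f : lp B ∞)) ∧
      (∀ t, Φ '' γ.dom t = δ.dom t) ∧
      (∀ t, ∀ f ∈ γ.dom t⁻¹, Φ (γ.act t f) = δ.act t (Φ f)) := by
  have hQ := BundlePartialAction.isUSCCStarBundle_orbitFiber hB hfree hproper
  have hcl := BundlePartialAction.isClosed_indZero hfree hproper hB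
  have hcl' := isClosed_cZero hQ
  have : T2Space α.base.OrbitSpace := α.base_cont.t2Space_orbitSpace hproper
  have : LocallyCompactSpace α.base.OrbitSpace :=
    α.base_cont.isOpenQuotientMap_orbit.locallyCompactSpace
  let μ := BundlePartialAction.quotient hfree hcomm.1 hcomm.2
  have hμ : α.IsQuotientAction β μ :=
    BundlePartialAction.isQuotientAction_quotient hfree hcomm.1 hcomm.2
  let δ := μ.cZeroCStar hQ
  have hδ : δ.IsGivenBy μ := μ.isGivenBy_cZeroCStar hQ
  let Φ := BundlePartialAction.indEquiv hfree hproper hB hQ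
  -- As `γ` is defined by transport of `δ`, the isomorphism intertwines the two by construction;
  -- only the formula in terms of `β` needs proof.
  let γ := δ.congr Φ (BundlePartialAction.isometry_indHom hB hQ).continuous
    (BundlePartialAction.isometry_indEquiv_symm hfree hproper hB hQ).continuous
  have hact : ∀ t, ∀ f ∈ γ.dom t⁻¹, Φ (γ.act t f) = δ.act t (Φ f) :=
    fun t f _ => Φ.apply_symm_apply _
  refine ⟨hcl, γ, BundlePartialAction.isGivenBy_of_ind hfree hcomm.2 hB hμ hδ
    (fun t f => Iff.rfl) hact, hQ, hcl', μ, δ, Φ, hμ, hδ, fun f => rfl, fun t => ?_, hact⟩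
  exact Φ.toEquiv.surjective.image_preimage _
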